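/- **Setting.** Languages are subsets of $\{0,1\}^*$. For languages $L_=$ (pursuer) and $L_{\ne}$ (evader), let $\Delta_0$ be the empty word and, for $i\ge 1$, let $\delta_i=1$ if $\Delta_{i-1}\in L_=\triangle L_{\ne}$ and $\delta_i=0$ otherwise, and $\Delta_i=\Delta_{i-1}\delta_i$. The payoffs of the evader and of the pursuer are $$S_{\ne}(L_=,L_{\ne})=\liminf_{N\to\infty}\sum_{n=1}^N\frac{\delta_n}{2N}+\limsup_{N\to\infty}\sum_{n=1}^N\frac{\delta_n}{2N},\qquad S_{=}(L_=,L_{\ne})=\liminf_{N\to\infty}\sum_{n=1}^N\frac{1-\delta_n}{2N}+\limsup_{N\to\infty}\sum_{n=1}^N\frac{1-\delta_n}{2N}.$$ A mixed strategy over a collection of languages is a (possibly incomputable) probability distribution on it. For mixed strategies $D_=,D_{\ne}$ the payoffs $S_{\ne}(D_=,D_{\ne})$ and $S_=(D_=,D_{\ne})$ are the expected payoffs for independent $L_=\sim D_=$, $L_{\ne}\sim D_{\ne}$, and $$\mathrm{minmax}(\Sigma_=,\Sigma_{\ne})=\inf_{D_=}\sup_{D_{\ne}}S_{\ne}(D_=,D_{\ne}),$$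 where $D_=$ and $D_{\ne}$ range over the mixed strategies over $\Sigma_=$ and $\Sigma_{\ne}$. Let $\Sigma^0_1$ be the collection of recursively enumerable languages and $\Pi^0_1$ the collection of languages with recursively enumerable complement. A language $L$ is nonadaptive if $u\in L\Leftrightarrow v\in L$ whenever $|u|=|v|$. For a computable enumeration $w_0,w_1,w_2,\ldots$ of all of $\{0,1\}^*$ put $NA(L)=\{x : w_{|x|}\in L\}$ and $NA(\Sigma)=\{NA(L) : L\in\Sigma\}$. A collection $\Sigma$ is learnable if $\mathrm{minmax}(\Sigma^0_1,NA(\Sigma))=0$. **Theorem.** $\Pi^0_1$ is learnable; that is, for every computable enumeration $w$ of $\{0,1\}^*$, $$\mathrm{minmax}\left(\Sigma^0_1,NA(\Pi^0_1)\right)=0 .$$ Moreover, there is a sequence $D_0,D_1,D_2,\ldots$ of mixed strategies over $\Sigma^0_1$, each of them the uniform mixture of a finite nonempty family (repetitions allowed) of recursively enumerable languages, such that $S_=(D_k,E)\to 1$ as $k\to\infty$, uniformly over all mixed strategies $E$ over the nonadaptive languages in $\Pi^0_1$ (in particular, uniformly over all single nonadaptive languages in $\Pi^0_1$). -/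

import Mathlib

open Filter Topology

noncomputable section

namespace IMP

/-- The history word `Δ_i` after `i` rounds when the players use `L₁` and `L₂`: the empty word,
extended at its end in each round by the bit recording whether the present history lies in the
symmetric difference of the two languages. -/
def history (L₁ L₂ : Language Bool) : ℕ → List Bool
  | 0 => []
  | i + 1 =>
    let d := history L₁ L₂ i
    open Classical in d ++ [decide (d ∈ symmDiff L₁ L₂)]

/-- The number `δ_n` for `n ≥ 1`: it is `1` if the two bits of round `n` differ and `0` if they
agree. (The value at `n = 0` is never used.) -/
def delta (L₁ L₂ : Language Bool) (n : ℕ) : ℝ :=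
  open Classical in if history L₁ L₂ (n - 1) ∈ symmDiff L₁ L₂ then 1 else 0

/-- The payoff `S_≠(L₁, L₂)` of the evader. -/
def payoffNe (L₁ L₂ : Language Bool) : ℝ :=
  liminf (fun N : ℕ => ∑ n ∈ Finset.Icc 1 N, delta L₁ L₂ n / (2 * (N : ℝ))) atTop +
    limsup (fun N : ℕ => ∑ n ∈ Finset.Icc 1 N, delta L₁ L₂ n / (2 * (N : ℝ))) atTop

/-- The payoff `S_=(L₁, L₂)` of the pursuer. -/
def payoffEq (L₁ L₂ : Language Bool) : ℝ :=
  liminf (fun N : ℕ => ∑ n ∈ Finset.Icc 1 N, (1 - delta L₁ L₂ n) / (2 * (N : ℝ))) atTop +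
    limsup (fun N : ℕ => ∑ n ∈ Finset.Icc 1 N, (1 - delta L₁ L₂ n) / (2 * (N : ℝ))) atTop

/-- A mixed strategy is a probability distribution over the collection `C`. The collections used
below are countable, so that every probability distribution is given by a mass function. -/
abbrev MixedStrategy (C : Set (Language Bool)) : Type := PMF C

/-- Expected payoff of the evader when `L₁ ∼ D₁` and `L₂ ∼ D₂` are drawn independently. -/
def expectedPayoffNe {C₁ C₂ : Set (Language Bool)} (D₁ : MixedStrategy C₁)
    (D₂ : MixedStrategy C₂) : ℝ :=
  ∑' p : C₁ × C₂, (D₁ p.1).toReal * (D₂ p.2).toReal * payoffNe p.1 p.2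

/-- Expected payoff of the pursuer when `L₁ ∼ D₁` and `L₂ ∼ D₂` are drawn independently. -/
def expectedPayoffEq {C₁ C₂ : Set (Language Bool)} (D₁ : MixedStrategy C₁)
    (D₂ : MixedStrategy C₂) : ℝ :=
  ∑' p : C₁ × C₂, (D₁ p.1).toReal * (D₂ p.2).toReal * payoffEq p.1 p.2

/-- `minmax(C₁, C₂)`: the infimum over the mixed strategies of the pursuer of the supremum over
the mixed strategies of the evader of the expected payoff of the evader. -/
def minmax (C₁ C₂ : Set (Language Bool)) : ℝ :=
  ⨅ D₁ : MixedStrategy C₁, ⨆ D₂ : MixedStrategy C₂, expectedPayoffNe D₁ D₂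

/-- `Σ⁰₁`: the recursively enumerable languages. -/
def Sigma01 : Set (Language Bool) := {L | REPred fun x : List Bool => x ∈ L}

/-- `Π⁰₁`: the languages with recursively enumerable complement. -/
def Pi01 : Set (Language Bool) := {L | REPred fun x : List Bool => x ∉ L}

/-- A nonadaptive language: membership depends on the length of the word only. -/
def IsNonadaptive (L : Language Bool) : Prop :=
  ∀ u v : List Bool, u.length = v.length → (u ∈ L ↔ v ∈ L)

/-- The language `NA(L)` with respect to the enumeration `w` of all words. -/
def NA (w : ℕ → List Bool) (L : Language Bool) : Language Bool :=
  {x : List Bool | w x.length ∈ L}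

/-- `C₂` is (conventionally) learnable by `C₁`, with respect to the enumeration `w`. -/
def LearnableBy (w : ℕ → List Bool) (C₁ C₂ : Set (Language Bool)) : Prop :=
  minmax C₁ (NA w '' C₂) = 0

/-- `C` is (conventionally) learnable: it is learnable by the recursively enumerable languages. -/
def Learnable (w : ℕ → List Bool) (C : Set (Language Bool)) : Prop :=
  LearnableBy w Sigma01 C

/-- `D` is the uniform mixture of a finite, nonempty family of members of `C`. -/
def IsFiniteUniformMixture {C : Set (Language Bool)} (D : MixedStrategy C) : Prop :=
  ∃ (n : ℕ) (L : Fin (n + 1) → C), D = (PMF.uniformOfFintype (Fin (n + 1))).map L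

end IMP

end

/-! The positions outside the evader's language form a recursively enumerable set; let `e` be an
index of it. Knowing `e`, the pursuer can accept at a position that is missing from some stage of
the enumeration, and errs only if the position enters later. If a rough count of the positions of a
block that will ever enter were known, it would suffice to wait until that count is reached: few
enter afterwards. The count is not computable, but it is approximable from below, and the pursuer
sends it to its own future through the mismatch bits of the history.

A fraction 1/(J+1) of each block is reserved, with a chunk of cells for each hypothesis; the rest is
payload. The final event count c of block i+1 is at most J+1, since payload entries are counted in
units of `width`. Chunk `e` of block i transmits c by two codes. In the ordered code, the first c
cells to enter are mismatched, later ones agree, and cells that never enter are mismatched. Once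
every agreeing cell has entered, c is the number of mismatched cells that have entered; this needs
at least one agreeing cell. In the other code, a cell of group m agrees exactly when it never enters
and m < c; c is readable if group c-1 has a cell that never enters.

Player z uses the ordered code on its own part of the cells, and also on the others if some group
outside that part is full. The code in use must be known, so fullness is one of the events announced
by the preceding block. Only block `e` has no announcement. There player z can fail only if group
c-1 is full outside its part; but then any other player has J+2 entered cells in its own part, more
than its count, so its ordered code is readable. Hence at most one of the M players fails
(`informed_of_not_informed`).

For the others, induction over blocks (`settled_and_informed`) and `payloadErrors_lt` bound the
payload errors under hypothesis `e`. Changing the hypothesis after each bad block, with every index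
recurring, leaves finitely many bad blocks (`exists_payloadErrors_lt`). The error density is then at
most 3/(J+1), and averaging over players adds at most 1/M. -/

namespace IMP

/-! ### The pursuer's strategy -/

section Strategy

/-- The number of positions reserved for one hypothesis in one block. -/
def chunkSize (M J : ℕ) : ℕ := M * (J + 1) * (J + 2)

/-- The number of reserved positions of block `i`. -/
def width (M J i : ℕ) : ℕ := (2 * i + 1) * chunkSize M J

/-- The first position of block `i`. -/
def blockStart (M J i : ℕ) : ℕ := chunkSize M J * (J + 1) * (i * i)

/-- The `x`-th position reserved for hypothesis `e` in block `i`. -/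
def cell (M J e i x : ℕ) : ℕ := blockStart M J i + e * chunkSize M J + x

/-- The `k`-th unreserved position of block `i`. -/
def payload (M J i k : ℕ) : ℕ := blockStart M J i + width M J i + k

/-- At stage `s` of the enumeration `A`, some group of cells of block `i` outside the part of
player `z` has been enumerated completely. -/
def GroupFull (A : ℕ → ℕ → Prop) (M J z e s i : ℕ) : Prop :=
  ∃ m < J + 1, ∀ x < chunkSize M J, x % M ≠ z → x / M % (J + 1) = m → A s (cell M J e i x)

open Classical in
/-- The number of events concerning block `i + 1` that have occurred by stage `s`. -/
noncomputable def eventCount (A : ℕ → ℕ → Prop) (M J z e s i : ℕ) : ℕ :=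
  (if GroupFull A M J z e s (i + 1) then 1 else 0) +
    ((Finset.range (J * width M J (i + 1))).filter
      fun k => A s (payload M J (i + 1) k)).card / width M J (i + 1)

open Classical in
/-- The number of cells on the same side as `x` that are enumerated before `x`. -/
noncomputable def rank (A : ℕ → ℕ → Prop) (M J z e s i x : ℕ) : ℕ :=
  ((Finset.range (chunkSize M J)).filter fun y => (y % M = z ↔ x % M = z) ∧
    ∃ t < s, A t (cell M J e i y) ∧ ¬ A t (cell M J e i x)).card

/-- The prediction of player `z` at a reserved cell. -/
def Answer (A : ℕ → ℕ → Prop) (M J z e s i x : ℕ) : Prop :=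
  ((x % M = z ∨ (e < i ∧ GroupFull A M J z e s i)) ∧
      (A s (cell M J e i x) ∧ rank A M J z e s i x < eventCount A M J z e s i)) ∨
    (¬ (x % M = z ∨ (e < i ∧ GroupFull A M J z e s i)) ∧
      (A s (cell M J e i x) ∨ x / M % (J + 1) < eventCount A M J z e s i))

open Classical in
/-- By stage `s`, the cells in `S` without mismatch are enumerated, and the event count has reached
the number of enumerated cells in `S` with a mismatch. -/
def Decoded (A : ℕ → ℕ → Prop) (M J z e : ℕ) (β : ℕ → Bool) (s i : ℕ) (S : ℕ → Prop) : Prop :=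
  (∀ x < chunkSize M J, S x → β (cell M J e i x) = false → A s (cell M J e i x)) ∧
    ((Finset.range (chunkSize M J)).filter fun x => S x ∧ β (cell M J e i x) = true ∧
      A s (cell M J e i x)).card ≤ eventCount A M J z e s i

/-- By stage `s`, the event count has reached the value that the mismatch bits of the reserved
cells of block `i` announce. -/
def RoundOk (A : ℕ → ℕ → Prop) (M J z e : ℕ) (β : ℕ → Bool) (s i : ℕ) : Prop :=
  ((∃ x < chunkSize M J, x % M = z ∧ β (cell M J e i x) = false) ∧
      Decoded A M J z e β s i fun x => x % M = z) ∨
    (¬ (∃ x < chunkSize M J, x % M = z ∧ β (cell M J e i x) = false) ∧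
      (((e < i ∧ GroupFull A M J z e s i) ∧ Decoded A M J z e β s i fun x => x % M ≠ z) ∨
        (¬ (e < i ∧ GroupFull A M J z e s i) ∧
          ∀ x < chunkSize M J, x % M ≠ z → β (cell M J e i x) = false →
            x / M % (J + 1) < eventCount A M J z e s i)))

/-- `RoundOk` holds in all blocks from `e` up to `i`. -/
def Chain (A : ℕ → ℕ → Prop) (M J z e : ℕ) (β : ℕ → Bool) (s i : ℕ) : Prop :=
  ∀ j < i, e ≤ j → RoundOk A M J z e β s j

open Classical in
/-- The number of mismatches at the unreserved positions of block `j`. -/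
noncomputable def payloadErrors (M J : ℕ) (β : ℕ → Bool) (j : ℕ) : ℕ :=
  ((Finset.range (J * width M J j)).filter fun k => β (payload M J j k) = true).card

open Classical in
/-- The number of blocks before block `i` with many mismatches. -/
noncomputable def badCount (M J : ℕ) (β : ℕ → Bool) (i : ℕ) : ℕ :=
  ((Finset.range i).filter fun j => width M J j ≤ payloadErrors M J β j).card

/-- The number `n` has been enumerated into the domain of the `e`-th partial computable function
before stage `s`. At most one number enters at each stage. -/
def enumStage (e s n : ℕ) : Prop :=
  ∃ t < s, t.unpair.1 = n ∧
    (Nat.Partrec.Code.evaln t.unpair.2 (Denumerable.ofNat Nat.Partrec.Code e) n).isSome = true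

/-- The bit at position `n` of the word `u`. -/
def bits (u : List Bool) (n : ℕ) : Bool := u.getD n false

/-- The block containing position `n`. -/
def blockIndex (M J n : ℕ) : ℕ := Nat.sqrt (n / (chunkSize M J * (J + 1)))

/-- The distance of position `n` from the start of its block. -/
def blockOffset (M J n : ℕ) : ℕ := n - blockStart M J (blockIndex M J n)

/-- The hypothesis that is followed at the unreserved positions of block `i`. -/
noncomputable def hypothesis (M J : ℕ) (β : ℕ → Bool) (i : ℕ) : ℕ := (badCount M J β i).unpair.1

/-- By stage `s`, player `z` has found a reason to accept the history `u`. -/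
def AcceptsAt (M J z : ℕ) (u : List Bool) (s : ℕ) : Prop :=
  (blockOffset M J u.length < width M J (blockIndex M J u.length) ∧
    blockOffset M J u.length / chunkSize M J ≤ blockIndex M J u.length ∧
    Chain (enumStage (blockOffset M J u.length / chunkSize M J)) M J z
      (blockOffset M J u.length / chunkSize M J) (bits u) s (blockIndex M J u.length) ∧
    Answer (enumStage (blockOffset M J u.length / chunkSize M J)) M J z
      (blockOffset M J u.length / chunkSize M J) s (blockIndex M J u.length)
      (blockOffset M J u.length % chunkSize M J)) ∨
  (¬ blockOffset M J u.length < width M J (blockIndex M J u.length) ∧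
    hypothesis M J (bits u) (blockIndex M J u.length) < blockIndex M J u.length ∧
    Chain (enumStage (hypothesis M J (bits u) (blockIndex M J u.length))) M J z
      (hypothesis M J (bits u) (blockIndex M J u.length)) (bits u) s
      (blockIndex M J u.length) ∧
    ¬ enumStage (hypothesis M J (bits u) (blockIndex M J u.length)) s u.length)

/-- The language of the pursuer `z`. -/
def pursuer (M J z : ℕ) : Language Bool := {u | ∃ s, AcceptsAt M J z u s}

end Strategy

/-! ### The pursuer's languages are recursively enumerable -/

section Computability

variable {α : Type*} [Primcodable α]

theorem primrecPred_forall_lt {P : α → ℕ → Prop} (hP : PrimrecPred fun p : α × ℕ => P p.1 p.2)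
    {n : α → ℕ} (hn : Primrec n) : PrimrecPred fun a => ∀ x < n a, P a x := by
  have h : PrimrecRel fun (x : ℕ) (a : α) => P a x :=
    hP.comp (Primrec.pair Primrec.snd Primrec.fst)
  exact (h.forall_mem_list.comp (Primrec.list_range.comp hn) Primrec.id).of_eq
    fun a => by simp

theorem primrecPred_exists_lt {P : α → ℕ → Prop} (hP : PrimrecPred fun p : α × ℕ => P p.1 p.2)
    {n : α → ℕ} (hn : Primrec n) : PrimrecPred fun a => ∃ x < n a, P a x := by
  have h : PrimrecRel fun (x : ℕ) (a : α) => P a x :=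
    hP.comp (Primrec.pair Primrec.snd Primrec.fst)
  exact (h.exists_mem_list.comp (Primrec.list_range.comp hn) Primrec.id).of_eq
    fun a => by simp

theorem primrec_card_filter_range {P : α → ℕ → Prop} [∀ a, DecidablePred (P a)]
    (hP : PrimrecPred fun p : α × ℕ => P p.1 p.2) {n : α → ℕ} (hn : Primrec n) :
    Primrec fun a => ((Finset.range (n a)).filter (P a)).card := by
  have h : PrimrecRel fun (x : ℕ) (a : α) => P a x :=
    hP.comp (Primrec.pair Primrec.snd Primrec.fst)
  have : DecidableRel fun (x : ℕ) (a : α) => P a x := fun x a => inferInstance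
  exact (Primrec.list_length.comp
    (h.listFilter.comp (Primrec.list_range.comp hn) Primrec.id)).of_eq fun a => by
      rw [Finset.card_def, Finset.filter_val, Finset.range_val, Multiset.range,
        Multiset.filter_coe, Multiset.coe_card]
      simp only [id]
      congr!

theorem primrecPred_imp {p q : α → Prop} (hp : PrimrecPred p) (hq : PrimrecPred q) :
    PrimrecPred fun a => p a → q a :=
  (hp.not.or hq).of_eq fun a => by tauto

theorem primrecPred_iff {p q : α → Prop} (hp : PrimrecPred p) (hq : PrimrecPred q) :
    PrimrecPred fun a => (p a ↔ q a) :=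
  ((primrecPred_imp hp hq).and (primrecPred_imp hq hp)).of_eq fun a => by tauto

theorem primrecPred_lt {f g : α → ℕ} (hf : Primrec f) (hg : Primrec g) :
    PrimrecPred fun a => f a < g a := Primrec.nat_lt.comp hf hg

theorem primrecPred_le {f g : α → ℕ} (hf : Primrec f) (hg : Primrec g) :
    PrimrecPred fun a => f a ≤ g a := Primrec.nat_le.comp hf hg

theorem primrecPred_eq {β : Type*} [Primcodable β] {f g : α → β} (hf : Primrec f)
    (hg : Primrec g) : PrimrecPred fun a => f a = g a := Primrec.eq.comp hf hg

theorem primrec_add {f g : α → ℕ} (hf : Primrec f) (hg : Primrec g) :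
    Primrec fun a => f a + g a := Primrec.nat_add.comp hf hg

theorem primrec_mul {f g : α → ℕ} (hf : Primrec f) (hg : Primrec g) :
    Primrec fun a => f a * g a := Primrec.nat_mul.comp hf hg

theorem primrec_div {f g : α → ℕ} (hf : Primrec f) (hg : Primrec g) :
    Primrec fun a => f a / g a := Primrec.nat_div.comp hf hg

theorem primrec_mod {f g : α → ℕ} (hf : Primrec f) (hg : Primrec g) :
    Primrec fun a => f a % g a := Primrec.nat_mod.comp hf hg

variable (M J z : ℕ) {e s i x : α → ℕ}

theorem primrec_width (hi : Primrec i) : Primrec fun a => width M J (i a) :=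
  primrec_mul (primrec_add (primrec_mul (.const 2) hi) (.const 1)) (.const _)

theorem primrec_blockStart (hi : Primrec i) : Primrec fun a => blockStart M J (i a) :=
  primrec_mul (.const _) (primrec_mul hi hi)

theorem primrec_cell (he : Primrec e) (hi : Primrec i) (hx : Primrec x) :
    Primrec fun a => cell M J (e a) (i a) (x a) :=
  primrec_add (primrec_add (primrec_blockStart M J hi) (primrec_mul he (.const _))) hx

theorem primrec_payload (hi : Primrec i) (hx : Primrec x) :
    Primrec fun a => payload M J (i a) (x a) :=
  primrec_add (primrec_add (primrec_blockStart M J hi) (primrec_width M J hi)) hx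

theorem primrecPred_enumStage (he : Primrec e) (hs : Primrec s) (hx : Primrec x) :
    PrimrecPred fun a => enumStage (e a) (s a) (x a) := by
  refine primrecPred_exists_lt (P := fun a t => t.unpair.1 = x a ∧
    (Nat.Partrec.Code.evaln t.unpair.2 (Denumerable.ofNat Nat.Partrec.Code (e a)) (x a)).isSome
      = true) ?_ hs
  have ht : Primrec fun p : α × ℕ => p.2.unpair := Primrec.unpair.comp Primrec.snd
  have hx' : Primrec fun p : α × ℕ => x p.1 := hx.comp Primrec.fst
  have he' : Primrec fun p : α × ℕ => e p.1 := he.comp Primrec.fst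
  exact (primrecPred_eq (Primrec.fst.comp ht) hx').and
    (primrecPred_eq (Primrec.option_isSome.comp (Nat.Partrec.Code.primrec_evaln.comp
      (((Primrec.snd.comp ht).pair ((Primrec.ofNat _).comp he')).pair hx'))) (.const true))

theorem primrecPred_groupFull (he : Primrec e) (hs : Primrec s) (hi : Primrec i) :
    PrimrecPred fun a => GroupFull (enumStage (e a)) M J z (e a) (s a) (i a) := by
  refine primrecPred_exists_lt (P := fun a m => ∀ x < chunkSize M J, x % M ≠ z →
    x / M % (J + 1) = m → enumStage (e a) (s a) (cell M J (e a) (i a) x)) ?_ (.const _)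
  refine primrecPred_forall_lt (P := fun (a : α × ℕ) x => x % M ≠ z →
    x / M % (J + 1) = a.2 → enumStage (e a.1) (s a.1) (cell M J (e a.1) (i a.1) x)) ?_ (.const _)
  have h1 : Primrec fun p : (α × ℕ) × ℕ => p.1.1 := Primrec.fst.comp Primrec.fst
  have h2 : Primrec fun p : (α × ℕ) × ℕ => p.1.2 := Primrec.snd.comp Primrec.fst
  have h3 : Primrec fun p : (α × ℕ) × ℕ => p.2 := Primrec.snd
  exact primrecPred_imp (primrecPred_eq (primrec_mod h3 (.const _)) (.const _)).not
    (primrecPred_imp (primrecPred_eq (primrec_mod (primrec_div h3 (.const _)) (.const _)) h2)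
      (primrecPred_enumStage (he.comp h1) (hs.comp h1)
        (primrec_cell M J (he.comp h1) (hi.comp h1) h3)))

theorem primrec_eventCount (he : Primrec e) (hs : Primrec s) (hi : Primrec i) :
    Primrec fun a => eventCount (enumStage (e a)) M J z (e a) (s a) (i a) := by
  classical
  have hi' : Primrec fun a => i a + 1 := primrec_add hi (.const 1)
  refine primrec_add (Primrec.ite (primrecPred_groupFull M J z he hs hi') (.const 1) (.const 0))
    (primrec_div ?_ (primrec_width M J hi'))
  refine primrec_card_filter_range (P := fun a k => enumStage (e a) (s a)
    (payload M J (i a + 1) k)) ?_ (primrec_mul (.const _) (primrec_width M J hi'))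
  exact primrecPred_enumStage (he.comp Primrec.fst) (hs.comp Primrec.fst)
    (primrec_payload M J (hi'.comp Primrec.fst) Primrec.snd)

theorem primrec_rank (he : Primrec e) (hs : Primrec s) (hi : Primrec i) (hx : Primrec x) :
    Primrec fun a => rank (enumStage (e a)) M J z (e a) (s a) (i a) (x a) := by
  classical
  refine primrec_card_filter_range (P := fun a y => (y % M = z ↔ x a % M = z) ∧ ∃ t < s a,
    enumStage (e a) t (cell M J (e a) (i a) y) ∧
      ¬ enumStage (e a) t (cell M J (e a) (i a) (x a))) ?_ (.const _)
  have hx' : Primrec fun p : α × ℕ => x p.1 := hx.comp Primrec.fst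
  refine (primrecPred_iff (primrecPred_eq (primrec_mod Primrec.snd (.const _)) (.const _))
    (primrecPred_eq (primrec_mod hx' (.const _)) (.const _))).and ?_
  refine primrecPred_exists_lt (P := fun (a : α × ℕ) t =>
    enumStage (e a.1) t (cell M J (e a.1) (i a.1) a.2) ∧
      ¬ enumStage (e a.1) t (cell M J (e a.1) (i a.1) (x a.1))) ?_ (hs.comp Primrec.fst)
  have h1 : Primrec fun p : (α × ℕ) × ℕ => p.1.1 := Primrec.fst.comp Primrec.fst
  have h2 : Primrec fun p : (α × ℕ) × ℕ => p.1.2 := Primrec.snd.comp Primrec.fst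
  have h3 : Primrec fun p : (α × ℕ) × ℕ => p.2 := Primrec.snd
  exact (primrecPred_enumStage (he.comp h1) h3
      (primrec_cell M J (he.comp h1) (hi.comp h1) h2)).and
    (primrecPred_enumStage (he.comp h1) h3
      (primrec_cell M J (he.comp h1) (hi.comp h1) (hx.comp h1))).not

theorem primrecPred_answer (he : Primrec e) (hs : Primrec s) (hi : Primrec i) (hx : Primrec x) :
    PrimrecPred fun a => Answer (enumStage (e a)) M J z (e a) (s a) (i a) (x a) := by
  have hm : PrimrecPred fun a => x a % M = z ∨
      (e a < i a ∧ GroupFull (enumStage (e a)) M J z (e a) (s a) (i a)) :=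
    (primrecPred_eq (primrec_mod hx (.const _)) (.const _)).or
      ((primrecPred_lt he hi).and (primrecPred_groupFull M J z he hs hi))
  have hA := primrecPred_enumStage he hs (primrec_cell M J he hi hx)
  have hc := primrec_eventCount M J z he hs hi
  exact (hm.and (hA.and (primrecPred_lt (primrec_rank M J z he hs hi hx) hc))).or
    (hm.not.and (hA.or (primrecPred_lt
      (primrec_mod (primrec_div hx (.const _)) (.const _)) hc)))

variable {u : α → List Bool}

theorem primrecPred_bits (b : Bool) (hu : Primrec u) (hx : Primrec x) :
    PrimrecPred fun a => bits (u a) (x a) = b :=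
  primrecPred_eq ((Primrec.list_getD false).comp hu hx) (.const b)

theorem primrecPred_decoded (S : ℕ → Prop) (hS : PrimrecPred S) (he : Primrec e)
    (hu : Primrec u) (hs : Primrec s) (hi : Primrec i) :
    PrimrecPred fun a => Decoded (enumStage (e a)) M J z (e a) (bits (u a)) (s a) (i a) S := by
  classical
  have hcell : Primrec fun p : α × ℕ => cell M J (e p.1) (i p.1) p.2 :=
    primrec_cell M J (he.comp Primrec.fst) (hi.comp Primrec.fst) Primrec.snd
  have hA : PrimrecPred fun p : α × ℕ =>
      enumStage (e p.1) (s p.1) (cell M J (e p.1) (i p.1) p.2) :=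
    primrecPred_enumStage (he.comp Primrec.fst) (hs.comp Primrec.fst) hcell
  have hS' : PrimrecPred fun p : α × ℕ => S p.2 := hS.comp Primrec.snd
  have hb (b : Bool) : PrimrecPred fun p : α × ℕ =>
      bits (u p.1) (cell M J (e p.1) (i p.1) p.2) = b :=
    primrecPred_bits b (hu.comp Primrec.fst) hcell
  refine PrimrecPred.and ?_ (primrecPred_le ?_ (primrec_eventCount M J z he hs hi))
  · exact primrecPred_forall_lt (P := fun a x => S x →
      bits (u a) (cell M J (e a) (i a) x) = false →
        enumStage (e a) (s a) (cell M J (e a) (i a) x))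
      (primrecPred_imp hS' (primrecPred_imp (hb false) hA)) (.const _)
  · exact primrec_card_filter_range (P := fun a x => S x ∧
      bits (u a) (cell M J (e a) (i a) x) = true ∧
        enumStage (e a) (s a) (cell M J (e a) (i a) x))
      (hS'.and ((hb true).and hA)) (.const _)

theorem primrecPred_roundOk (he : Primrec e) (hu : Primrec u) (hs : Primrec s)
    (hi : Primrec i) :
    PrimrecPred fun a => RoundOk (enumStage (e a)) M J z (e a) (bits (u a)) (s a) (i a) := by
  have hcell : Primrec fun p : α × ℕ => cell M J (e p.1) (i p.1) p.2 :=
    primrec_cell M J (he.comp Primrec.fst) (hi.comp Primrec.fst) Primrec.snd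
  have hb : PrimrecPred fun p : α × ℕ =>
      bits (u p.1) (cell M J (e p.1) (i p.1) p.2) = false :=
    primrecPred_bits false (hu.comp Primrec.fst) hcell
  have hown : PrimrecPred fun x : ℕ => x % M = z :=
    primrecPred_eq (primrec_mod Primrec.id (.const _)) (.const _)
  have h1 : PrimrecPred fun a => ∃ x < chunkSize M J, x % M = z ∧
      bits (u a) (cell M J (e a) (i a) x) = false :=
    primrecPred_exists_lt (P := fun a x => x % M = z ∧
      bits (u a) (cell M J (e a) (i a) x) = false)
      ((hown.comp Primrec.snd).and hb) (.const _)
  have h2 : PrimrecPred fun a =>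
      e a < i a ∧ GroupFull (enumStage (e a)) M J z (e a) (s a) (i a) :=
    (primrecPred_lt he hi).and (primrecPred_groupFull M J z he hs hi)
  refine (h1.and (primrecPred_decoded M J z _ hown he hu hs hi)).or (h1.not.and
    ((h2.and (primrecPred_decoded M J z _ hown.not he hu hs hi)).or (h2.not.and ?_)))
  refine primrecPred_forall_lt (P := fun a x => x % M ≠ z →
    bits (u a) (cell M J (e a) (i a) x) = false →
      x / M % (J + 1) < eventCount (enumStage (e a)) M J z (e a) (s a) (i a)) ?_ (.const _)
  exact primrecPred_imp (hown.comp Primrec.snd).not (primrecPred_imp hb (primrecPred_lt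
    (primrec_mod (primrec_div Primrec.snd (.const _)) (.const _))
    ((primrec_eventCount M J z he hs hi).comp Primrec.fst)))

theorem primrecPred_chain (he : Primrec e) (hu : Primrec u) (hs : Primrec s)
    (hi : Primrec i) :
    PrimrecPred fun a => Chain (enumStage (e a)) M J z (e a) (bits (u a)) (s a) (i a) := by
  refine primrecPred_forall_lt (P := fun a j => e a ≤ j →
    RoundOk (enumStage (e a)) M J z (e a) (bits (u a)) (s a) j) ?_ hi
  exact primrecPred_imp (primrecPred_le (he.comp Primrec.fst) Primrec.snd)
    (primrecPred_roundOk M J z (he.comp Primrec.fst) (hu.comp Primrec.fst)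
      (hs.comp Primrec.fst) Primrec.snd)

theorem primrec_hypothesis (hu : Primrec u) (hi : Primrec i) :
    Primrec fun a => hypothesis M J (bits (u a)) (i a) := by
  classical
  refine Primrec.fst.comp (Primrec.unpair.comp ?_)
  refine primrec_card_filter_range (P := fun a j => width M J j ≤ payloadErrors M J (bits (u a)) j)
    (primrecPred_le (primrec_width M J Primrec.snd) ?_) hi
  refine primrec_card_filter_range (P := fun (a : α × ℕ) k =>
    bits (u a.1) (payload M J a.2 k) = true) ?_
    (primrec_mul (.const _) (primrec_width M J Primrec.snd))
  exact primrecPred_bits true (hu.comp (Primrec.fst.comp Primrec.fst))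
    (primrec_payload M J (Primrec.snd.comp Primrec.fst) Primrec.snd)

theorem primrecPred_acceptsAt (hu : Primrec u) (hs : Primrec s) :
    PrimrecPred fun a => AcceptsAt M J z (u a) (s a) := by
  have hn : Primrec fun a => (u a).length := Primrec.list_length.comp hu
  have hi : Primrec fun a => blockIndex M J (u a).length :=
    Primrec.nat_sqrt.comp (primrec_div hn (.const _))
  have ho : Primrec fun a => blockOffset M J (u a).length :=
    Primrec.nat_sub.comp hn (primrec_blockStart M J hi)
  have hw := primrecPred_lt ho (primrec_width M J hi)
  have he := primrec_div ho (Primrec.const (chunkSize M J))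
  have hx := primrec_mod ho (Primrec.const (chunkSize M J))
  have hh := primrec_hypothesis M J hu hi
  exact (hw.and ((primrecPred_le he hi).and ((primrecPred_chain M J z he hu hs hi).and
      (primrecPred_answer M J z he hs hi hx)))).or
    (hw.not.and ((primrecPred_lt hh hi).and ((primrecPred_chain M J z hh hu hs hi).and
      (primrecPred_enumStage hh hs hn).not)))

/-- Unbounded search for a stage turns a primitive recursive stagewise test into a semidecision
procedure. -/
theorem rePred_exists {P : α → ℕ → Prop} (hP : PrimrecPred fun p : α × ℕ => P p.1 p.2) :
    REPred fun a => ∃ s, P a s := by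
  classical
  have h : Computable fun p : α × ℕ => decide (P p.1 p.2) := hP.decide.to_comp
  have h2 : Partrec₂ fun (a : α) (s : ℕ) => (Part.some (decide (P a s)) : Part Bool) := h.partrec
  refine (Partrec.rfind h2).dom_re.of_eq fun a => ?_
  refine Nat.rfind_dom.trans ?_
  simp

theorem pursuer_mem_Sigma01 : pursuer M J z ∈ Sigma01 :=
  rePred_exists (P := fun u s => AcceptsAt M J z u s)
    (primrecPred_acceptsAt M J z Primrec.fst Primrec.snd)

end Computability


/-! ### Stagewise enumerations -/

section Enumeration

/-- A stagewise enumeration in which no two numbers enter at the same stage. -/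
structure IsEnumeration (A : ℕ → ℕ → Prop) : Prop where
  mono : ∀ ⦃s t n⦄, s ≤ t → A s n → A t n
  separated : ∀ ⦃s n m⦄, A s n → A s m → n ≠ m →
    (∃ t < s, A t n ∧ ¬ A t m) ∨ ∃ t < s, A t m ∧ ¬ A t n

/-- The enumerated set, as an enumeration that is complete at every stage. -/
def limitStage (A : ℕ → ℕ → Prop) (_ n : ℕ) : Prop := ∃ t, A t n

/-- The stage at which a number is enumerated. -/
noncomputable def entryTime (A : ℕ → ℕ → Prop) (n : ℕ) : ℕ := sInf {t | A t n}

variable {A : ℕ → ℕ → Prop}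

theorem IsEnumeration.stage_iff (hA : IsEnumeration A) {s n : ℕ} (hn : limitStage A 0 n) :
    A s n ↔ entryTime A n ≤ s :=
  ⟨fun h => Nat.sInf_le h, fun h => hA.mono h (Nat.sInf_mem (s := {t | A t n}) hn)⟩

theorem IsEnumeration.entryTime_injOn (hA : IsEnumeration A) {n m : ℕ} (hn : limitStage A 0 n)
    (hm : limitStage A 0 m) (h : entryTime A n = entryTime A m) : n = m := by
  by_contra hne
  rcases hA.separated ((hA.stage_iff hn).2 le_rfl) ((hA.stage_iff hm).2 h.ge) hne with
    ⟨t, -, h1, h2⟩ | ⟨t, -, h1, h2⟩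
  · rw [hA.stage_iff hn] at h1; rw [hA.stage_iff hm] at h2; omega
  · rw [hA.stage_iff hm] at h1; rw [hA.stage_iff hn] at h2; omega

theorem IsEnumeration.exists_stage (hA : IsEnumeration A) (B : ℕ) :
    ∃ s₀, ∀ s ≥ s₀, ∀ n < B, (A s n ↔ limitStage A 0 n) := by
  induction B with
  | zero => exact ⟨0, fun _ _ _ h => absurd h (Nat.not_lt_zero _)⟩
  | succ B ih =>
    obtain ⟨s₀, h₀⟩ := ih
    refine ⟨max s₀ (entryTime A B), fun s hs n hn => ?_⟩
    rcases Nat.lt_succ_iff_lt_or_eq.1 hn with hn | rfl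
    · exact h₀ s (le_trans (le_max_left _ _) hs) n hn
    · exact ⟨fun h => ⟨s, h⟩, fun h => (hA.stage_iff h).2 (le_trans (le_max_right _ _) hs)⟩

theorem isEnumeration_enumStage (e : ℕ) : IsEnumeration (enumStage e) where
  mono := fun s t n hst ⟨r, hr, h⟩ => ⟨r, hr.trans_le hst, h⟩
  separated := by
    classical
    intro s n m hn hm hne
    have hfn := Nat.find_spec hn
    have hfm := Nat.find_spec hm
    rcases lt_trichotomy (Nat.find hn) (Nat.find hm) with h | h | h
    · refine Or.inl ⟨Nat.find hm, hfm.1, ⟨Nat.find hn, h, hfn.2⟩, ?_⟩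
      rintro ⟨r, hr, h'⟩
      exact Nat.find_min hm hr ⟨hr.trans hfm.1, h'⟩
    · exact absurd (hfn.2.1.symm.trans (h ▸ hfm.2.1)) hne
    · refine Or.inr ⟨Nat.find hn, hfn.1, ⟨Nat.find hm, h, hfm.2⟩, ?_⟩
      rintro ⟨r, hr, h'⟩
      exact Nat.find_min hn hr ⟨hr.trans hfn.1, h'⟩

theorem limitStage_enumStage (e n : ℕ) : limitStage (enumStage e) 0 n ↔
    (Nat.Partrec.Code.eval (Denumerable.ofNat Nat.Partrec.Code e) n).Dom := by
  constructor
  · rintro ⟨_, t, -, rfl, h⟩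
    obtain ⟨x, hx⟩ := Option.isSome_iff_exists.1 h
    exact Part.dom_iff_mem.2 ⟨x, Nat.Partrec.Code.evaln_sound hx⟩
  · intro h
    obtain ⟨x, hx⟩ := Part.dom_iff_mem.1 h
    obtain ⟨k, hk⟩ := Nat.Partrec.Code.evaln_complete.1 hx
    refine ⟨Nat.pair n k + 1, Nat.pair n k, Nat.lt_succ_self _, by simp, ?_⟩
    simpa using Option.isSome_iff_exists.2 ⟨x, hk⟩

end Enumeration

/-! ### Ranks in a finite set with an injective time function -/

section Ranking

variable {ι : Type*} (T : Finset ι) {τ : ι → ℕ}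

/-- Rank is strictly increasing in `τ`, hence injective on `T`, and its values lie below `T.card`;
so every such value is attained. -/
theorem image_rank (hτ : Set.InjOn τ T) :
    T.image (fun x => (T.filter fun y => τ y < τ x).card) = Finset.range T.card := by
  classical
  have hlt : ∀ x ∈ T, ∀ y ∈ T, τ x < τ y →
      (T.filter fun w => τ w < τ x).card < (T.filter fun w => τ w < τ y).card := by
    intro x hx y _ hxy
    refine Finset.card_lt_card ⟨fun w hw => ?_, fun h => ?_⟩
    · rw [Finset.mem_filter] at hw ⊢
      exact ⟨hw.1, hw.2.trans hxy⟩
    · have := h (Finset.mem_filter.2 ⟨hx, hxy⟩)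
      simp at this
  refine Finset.eq_of_subset_of_card_le ?_ ?_
  · intro r hr
    obtain ⟨x, hx, rfl⟩ := Finset.mem_image.1 hr
    refine Finset.mem_range.2 (Finset.card_lt_card ⟨Finset.filter_subset _ _, fun h => ?_⟩)
    have := h hx
    simp at this
  · rw [Finset.card_range, Finset.card_image_of_injOn]
    intro x hx y hy hxy
    rcases lt_trichotomy (τ x) (τ y) with h | h | h
    · exact absurd hxy (hlt x hx y hy h).ne
    · exact hτ hx hy h
    · exact absurd hxy (hlt y hy x hx h).ne'

theorem card_filter_rank_lt (hτ : Set.InjOn τ T) {c : ℕ} (hc : c ≤ T.card) :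
    (T.filter fun x => (T.filter fun y => τ y < τ x).card < c).card = c := by
  classical
  have himg := image_rank T hτ
  have hinj : Set.InjOn (fun x => (T.filter fun y => τ y < τ x).card) T := by
    rw [← Finset.card_image_iff, himg, Finset.card_range]
  have h : (T.filter fun x => (T.filter fun y => τ y < τ x).card < c).image
      (fun x => (T.filter fun y => τ y < τ x).card) = Finset.range c := by
    ext r
    constructor
    · intro hr
      obtain ⟨x, hx, rfl⟩ := Finset.mem_image.1 hr
      exact Finset.mem_range.2 (Finset.mem_filter.1 hx).2
    · intro hr
      have hr' : r ∈ Finset.range T.card :=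
        Finset.mem_range.2 ((Finset.mem_range.1 hr).trans_le hc)
      rw [← himg] at hr'
      obtain ⟨x, hx, rfl⟩ := Finset.mem_image.1 hr'
      exact Finset.mem_image.2
        ⟨x, Finset.mem_filter.2 ⟨hx, Finset.mem_range.1 hr⟩, rfl⟩
  have h' := congrArg Finset.card h
  rwa [Finset.card_image_of_injOn (hinj.mono fun x hx => (Finset.mem_filter.1 hx).1),
    Finset.card_range] at h'

theorem exists_le_rank (hτ : Set.InjOn τ T) {c : ℕ} (hc : c < T.card) :
    ∃ x ∈ T, c ≤ (T.filter fun y => τ y < τ x).card := by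
  classical
  have h : c ∈ Finset.range T.card := Finset.mem_range.2 hc
  rw [← image_rank T hτ] at h
  obtain ⟨x, hx, h⟩ := Finset.mem_image.1 h
  exact ⟨x, hx, h.ge⟩

theorem rank_lt_card {x : ι} (hx : x ∈ T) : (T.filter fun y => τ y < τ x).card < T.card := by
  refine Finset.card_lt_card ⟨Finset.filter_subset _ _, fun h => ?_⟩
  have := h hx
  simp at this

end Ranking

/-! ### Arithmetic of blocks and cells -/

section Layout

variable (M J : ℕ)

/-- Consecutive squares differ by 2i+1. Quadratic starts make block lengths negligible against their
starting positions, while leaving room for hypotheses up to `i`. -/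
theorem blockStart_succ (i : ℕ) :
    blockStart M J (i + 1) = blockStart M J i + (width M J i + J * width M J i) := by
  unfold blockStart width; ring

theorem blockStart_mono {i j : ℕ} (h : i ≤ j) : blockStart M J i ≤ blockStart M J j :=
  Nat.mul_le_mul_left _ (Nat.mul_le_mul h h)

theorem width_pos {M J : ℕ} (hM : 0 < M) (i : ℕ) : 0 < width M J i := by
  unfold width chunkSize; positivity

theorem chunkSize_pos {M J : ℕ} (hM : 0 < M) : 0 < chunkSize M J := by
  unfold chunkSize; positivity

theorem blockStart_le_cell (e i x : ℕ) : blockStart M J i ≤ cell M J e i x := by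
  unfold cell; omega

theorem cell_offset_lt {M J e i x : ℕ} (he : e ≤ i) (hx : x < chunkSize M J) :
    e * chunkSize M J + x < width M J i := by
  unfold width
  have h1 : e * chunkSize M J ≤ (2 * i) * chunkSize M J := Nat.mul_le_mul_right _ (by omega)
  have h2 : (2 * i + 1) * chunkSize M J = (2 * i) * chunkSize M J + chunkSize M J := by ring
  omega

theorem cell_lt {M J e i x : ℕ} (he : e ≤ i) (hx : x < chunkSize M J) :
    cell M J e i x < blockStart M J (i + 1) := by
  have := cell_offset_lt he hx
  rw [blockStart_succ]
  unfold cell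
  omega

theorem cell_injective (e i : ℕ) : Function.Injective (cell M J e i) := by
  intro x y h
  unfold cell at h
  omega

theorem payload_lt {M J i k : ℕ} (hk : k < J * width M J i) :
    payload M J i k < blockStart M J (i + 1) := by
  rw [blockStart_succ]
  unfold payload
  omega

theorem blockIndex_eq {M J : ℕ} (hM : 0 < M) {n i : ℕ} (h1 : blockStart M J i ≤ n)
    (h2 : n < blockStart M J (i + 1)) : blockIndex M J n = i := by
  have hC : 0 < chunkSize M J * (J + 1) := Nat.mul_pos (chunkSize_pos hM) (by omega)
  unfold blockIndex
  symm
  rw [Nat.eq_sqrt]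
  constructor
  · rw [Nat.le_div_iff_mul_le hC, mul_comm]
    exact h1
  · rw [Nat.div_lt_iff_lt_mul hC, mul_comm]
    exact h2

/-- The cell of a chunk with the given part, group and copy number. -/
theorem cell_coordinates {M J z m y : ℕ} (hz : z < M) (hm : m < J + 1) (hy : y < J + 2) :
    z + M * (m + (J + 1) * y) < chunkSize M J ∧ (z + M * (m + (J + 1) * y)) % M = z ∧
      (z + M * (m + (J + 1) * y)) / M % (J + 1) = m := by
  refine ⟨?_, ?_, ?_⟩
  · have h1 : m + (J + 1) * y + 1 ≤ (J + 1) * (J + 2) := by nlinarith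
    calc z + M * (m + (J + 1) * y) < M + M * (m + (J + 1) * y) := by omega
      _ = M * (m + (J + 1) * y + 1) := by ring
      _ ≤ M * ((J + 1) * (J + 2)) := Nat.mul_le_mul_left _ h1
      _ = chunkSize M J := by unfold chunkSize; ring
  · rw [Nat.add_mul_mod_self_left, Nat.mod_eq_of_lt hz]
  · rw [Nat.add_mul_div_left _ _ (by omega), Nat.div_eq_of_lt hz, zero_add,
      Nat.add_mul_mod_self_left, Nat.mod_eq_of_lt hm]

end Layout

/-! ### Events and their count -/

section Events

variable {A A' : ℕ → ℕ → Prop} {M J z e s t i : ℕ}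

theorem GroupFull.imp (h : ∀ n, A s n → A' t n) (hf : GroupFull A M J z e s i) :
    GroupFull A' M J z e t i := by
  obtain ⟨m, hm, h'⟩ := hf
  exact ⟨m, hm, fun x hx h1 h2 => h _ (h' x hx h1 h2)⟩

theorem groupFull_congr (he : e ≤ i) (h : ∀ n < blockStart M J (i + 1), (A s n ↔ A' t n)) :
    GroupFull A M J z e s i ↔ GroupFull A' M J z e t i := by
  unfold GroupFull
  refine exists_congr fun m => and_congr_right fun _ => forall₂_congr fun x hx => ?_
  rw [h _ (cell_lt he hx)]

theorem eventCount_le_of_imp (h : ∀ n, A s n → A' t n) :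
    eventCount A M J z e s i ≤ eventCount A' M J z e t i := by
  classical
  unfold eventCount
  refine add_le_add ?_ (Nat.div_le_div_right (Finset.card_le_card fun k hk => ?_))
  · by_cases hf : GroupFull A M J z e s (i + 1)
    · rw [if_pos hf, if_pos (hf.imp h)]
    · rw [if_neg hf]; exact Nat.zero_le _
  · rw [Finset.mem_filter] at hk ⊢
    exact ⟨hk.1, h _ hk.2⟩

theorem eventCount_congr (he : e ≤ i) (h : ∀ n < blockStart M J (i + 2), (A s n ↔ A' t n)) :
    eventCount A M J z e s i = eventCount A' M J z e t i := by
  classical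
  unfold eventCount
  have h1 := groupFull_congr (z := z) (he.trans (Nat.le_succ i)) h
  congr 1
  · simp only [h1]
  · congr 2
    refine Finset.filter_congr fun k hk => h _ (payload_lt (Finset.mem_range.1 hk))

theorem eventCount_le (A : ℕ → ℕ → Prop) (M J z e s i : ℕ) :
    eventCount A M J z e s i ≤ J + 1 := by
  classical
  unfold eventCount
  have h1 : ((Finset.range (J * width M J (i + 1))).filter
      fun k => A s (payload M J (i + 1) k)).card / width M J (i + 1) ≤ J := by
    refine Nat.div_le_of_le_mul ?_
    rw [mul_comm]
    exact (Finset.card_filter_le _ _).trans (Finset.card_range _).le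
  split_ifs <;> omega

-- Both summands of the count are monotone, so equality of the sums forces equality of each. Equal
-- quotients by `width` leave fewer than `width` late entries.
open Classical in
theorem eventCount_eq_imp (hA : ∀ n, A s n → A' t n)
    (h : eventCount A M J z e s i = eventCount A' M J z e t i) (hM : 0 < M) :
    (GroupFull A M J z e s (i + 1) ↔ GroupFull A' M J z e t (i + 1)) ∧
      ((Finset.range (J * width M J (i + 1))).filter fun k =>
        A' t (payload M J (i + 1) k) ∧ ¬ A s (payload M J (i + 1) k)).card <
          width M J (i + 1) := by
  classical
  unfold eventCount at h
  have hsub : (Finset.range (J * width M J (i + 1))).filter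
      (fun k => A s (payload M J (i + 1) k)) ⊆ (Finset.range (J * width M J (i + 1))).filter
      (fun k => A' t (payload M J (i + 1) k)) := fun k hk => by
    rw [Finset.mem_filter] at hk ⊢
    exact ⟨hk.1, hA _ hk.2⟩
  have hdiv := Nat.div_le_div_right (c := width M J (i + 1)) (Finset.card_le_card hsub)
  have hf : GroupFull A M J z e s (i + 1) → GroupFull A' M J z e t (i + 1) :=
    fun hf => hf.imp hA
  have hw := width_pos (J := J) hM (i + 1)
  have key : (GroupFull A M J z e s (i + 1) ↔ GroupFull A' M J z e t (i + 1)) ∧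
      ((Finset.range (J * width M J (i + 1))).filter
        fun k => A s (payload M J (i + 1) k)).card / width M J (i + 1) =
      ((Finset.range (J * width M J (i + 1))).filter
        fun k => A' t (payload M J (i + 1) k)).card / width M J (i + 1) := by
    by_cases h1 : GroupFull A M J z e s (i + 1)
    · simp only [h1, hf h1, if_true] at h
      exact ⟨by simp [h1, hf h1], by omega⟩
    · by_cases h2 : GroupFull A' M J z e t (i + 1)
      · simp only [h1, h2, if_true, if_false] at h
        omega
      · simp only [h1, h2, if_false] at h
        exact ⟨by simp [h1, h2], by omega⟩
  refine ⟨key.1, ?_⟩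
  have hsd : (Finset.range (J * width M J (i + 1))).filter (fun k =>
        A' t (payload M J (i + 1) k) ∧ ¬ A s (payload M J (i + 1) k)) =
      (Finset.range (J * width M J (i + 1))).filter (fun k => A' t (payload M J (i + 1) k)) \
      (Finset.range (J * width M J (i + 1))).filter (fun k => A s (payload M J (i + 1) k)) := by
    ext k
    simp only [Finset.mem_filter, Finset.mem_sdiff]
    tauto
  rw [hsd, Finset.card_sdiff_of_subset hsub]
  have a1 := Nat.div_add_mod ((Finset.range (J * width M J (i + 1))).filter
    fun k => A s (payload M J (i + 1) k)).card (width M J (i + 1))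
  have a2 := Nat.div_add_mod ((Finset.range (J * width M J (i + 1))).filter
    fun k => A' t (payload M J (i + 1) k)).card (width M J (i + 1))
  have a3 := Nat.mod_lt ((Finset.range (J * width M J (i + 1))).filter
    fun k => A' t (payload M J (i + 1) k)).card hw
  rw [key.2] at a1
  omega

end Events

/-! ### Dependence on the past only -/

section Congruence

variable {A : ℕ → ℕ → Prop} {M J z e s i : ℕ} {β γ : ℕ → Bool}

theorem roundOk_congr (h : ∀ x < chunkSize M J, β (cell M J e i x) = γ (cell M J e i x)) :
    RoundOk A M J z e β s i ↔ RoundOk A M J z e γ s i := by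
  classical
  have h1 : (∃ x < chunkSize M J, x % M = z ∧ β (cell M J e i x) = false) ↔
      ∃ x < chunkSize M J, x % M = z ∧ γ (cell M J e i x) = false :=
    exists_congr fun x => and_congr_right fun hx => by rw [h x hx]
  have h2 (S : ℕ → Prop) : Decoded A M J z e β s i S ↔ Decoded A M J z e γ s i S := by
    unfold Decoded
    refine and_congr (forall₂_congr fun x hx => by rw [h x hx]) ?_
    rw [Finset.filter_congr (q := fun x => S x ∧ γ (cell M J e i x) = true ∧
      A s (cell M J e i x)) fun x hx => by rw [h x (Finset.mem_range.1 hx)]]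
  have h3 : (∀ x < chunkSize M J, x % M ≠ z → β (cell M J e i x) = false →
      x / M % (J + 1) < eventCount A M J z e s i) ↔
      ∀ x < chunkSize M J, x % M ≠ z → γ (cell M J e i x) = false →
      x / M % (J + 1) < eventCount A M J z e s i :=
    forall₂_congr fun x hx => by rw [h x hx]
  unfold RoundOk
  rw [h1, h2, h2, h3]

/-- The chain for block `i` reads only cells of earlier blocks, so every history ending in block `i`
evaluates it in the same way. -/
theorem chain_congr (h : ∀ n < blockStart M J i, β n = γ n) :
    Chain A M J z e β s i ↔ Chain A M J z e γ s i :=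
  forall₂_congr fun _ hj => forall_congr' fun he => roundOk_congr fun _ hx =>
    h _ ((cell_lt he hx).trans_le (blockStart_mono M J hj))

theorem hypothesis_congr (h : ∀ n < blockStart M J i, β n = γ n) :
    hypothesis M J β i = hypothesis M J γ i := by
  classical
  unfold hypothesis badCount
  congr 3
  refine Finset.filter_congr fun j hj => ?_
  have : payloadErrors M J β j = payloadErrors M J γ j := by
    unfold payloadErrors
    congr 1
    refine Finset.filter_congr fun k hk => ?_
    rw [h _ ((payload_lt (Finset.mem_range.1 hk)).trans_le
      (blockStart_mono M J (Finset.mem_range.1 hj)))]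
  rw [this]

end Congruence


/-! ### Transmitting the event count from block to block -/

section Tracking

/-- The cells of the side `S` that are eventually enumerated. -/
noncomputable def enumerated (A : ℕ → ℕ → Prop) (M J e i : ℕ) (S : ℕ → Prop) : Finset ℕ :=
  open Classical in (Finset.range (chunkSize M J)).filter fun y =>
    S y ∧ limitStage A 0 (cell M J e i y)

/-- The number of cells of the side `S` that are enumerated before the cell `x`. -/
noncomputable def limitRank (A : ℕ → ℕ → Prop) (M J e i : ℕ) (S : ℕ → Prop) (x : ℕ) : ℕ :=
  ((enumerated A M J e i S).filter fun y =>
    entryTime A (cell M J e i y) < entryTime A (cell M J e i x)).card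

/-- The final value of the event count. -/
noncomputable def limitCount (A : ℕ → ℕ → Prop) (M J z e i : ℕ) : ℕ :=
  eventCount (limitStage A) M J z e 0 i

/-- The bits `d` record where the answers of player `z` at the reserved cells of block `i` agree
with the enumerated set. -/
def Follows (A : ℕ → ℕ → Prop) (M J z e : ℕ) (d : ℕ → Bool) (i : ℕ) : Prop :=
  ∀ x < chunkSize M J, (d (cell M J e i x) = true ↔
    ((∃ s, Chain A M J z e d s i ∧ Answer A M J z e s i x) ↔ limitStage A 0 (cell M J e i x)))

/-- The bits of the reserved cells of block `i` determine the final event count. -/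
def Informed (A : ℕ → ℕ → Prop) (M J z e : ℕ) (d : ℕ → Bool) (i : ℕ) : Prop :=
  (∃ x < chunkSize M J, x % M = z ∧ d (cell M J e i x) = false) ∨
    (e < i ∧ GroupFull (limitStage A) M J z e 0 i) ∨ limitCount A M J z e i = 0 ∨
    ∃ x < chunkSize M J, x % M ≠ z ∧ x / M % (J + 1) + 1 = limitCount A M J z e i ∧
      ¬ limitStage A 0 (cell M J e i x)

/-- The chain condition is eventually true, and from then on fullness of groups is decided. -/
structure Settled (A : ℕ → ℕ → Prop) (M J z e : ℕ) (d : ℕ → Bool) (i : ℕ) : Prop where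
  chain : ∃ s₀, ∀ s ≥ s₀, Chain A M J z e d s i
  groupFull : ∀ s, Chain A M J z e d s i → e < i →
    (GroupFull A M J z e s i ↔ GroupFull (limitStage A) M J z e 0 i)

variable {A : ℕ → ℕ → Prop} {M J z e i : ℕ} {d : ℕ → Bool}

theorem mem_enumerated {S : ℕ → Prop} {y : ℕ} : y ∈ enumerated A M J e i S ↔
    y < chunkSize M J ∧ S y ∧ limitStage A 0 (cell M J e i y) := by
  classical
  unfold enumerated
  rw [Finset.mem_filter, Finset.mem_range]

theorem entryTime_cell_injOn (hA : IsEnumeration A) (S : ℕ → Prop) :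
    Set.InjOn (fun y => entryTime A (cell M J e i y)) (enumerated A M J e i S) :=
  fun _ hx _ hy h => cell_injective M J e i
    (hA.entryTime_injOn (mem_enumerated.1 hx).2.2 (mem_enumerated.1 hy).2.2 h)

/-- Once `x` has entered, every cell that ever precedes it has entered too, so its rank is already
final. -/
theorem rank_eq_limitRank (hA : IsEnumeration A) {s x : ℕ} {S : ℕ → Prop}
    (hS : ∀ y, (y % M = z ↔ x % M = z) ↔ S y) (hx : A s (cell M J e i x)) :
    rank A M J z e s i x = limitRank A M J e i S x := by
  classical
  unfold rank limitRank
  congr 1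
  ext y
  simp only [Finset.mem_filter, mem_enumerated, hS, Finset.mem_range]
  have hlx : limitStage A 0 (cell M J e i x) := ⟨s, hx⟩
  constructor
  · rintro ⟨hy, hSy, t, -, h1, h2⟩
    have hly : limitStage A 0 (cell M J e i y) := ⟨t, h1⟩
    refine ⟨⟨hy, hSy, hly⟩, ?_⟩
    rw [hA.stage_iff hly] at h1
    rw [hA.stage_iff hlx] at h2
    omega
  · rintro ⟨⟨hy, hSy, hly⟩, h⟩
    refine ⟨hy, hSy, _, h.trans_le ((hA.stage_iff hlx).1 hx), (hA.stage_iff hly).2 le_rfl, ?_⟩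
    rw [hA.stage_iff hlx]
    omega

theorem eventCount_le_limitCount (s : ℕ) : eventCount A M J z e s i ≤ limitCount A M J z e i :=
  eventCount_le_of_imp fun _ h => ⟨s, h⟩

theorem eventCount_eventually (hA : IsEnumeration A) (he : e ≤ i) :
    ∃ s₀, ∀ s ≥ s₀, eventCount A M J z e s i = limitCount A M J z e i := by
  obtain ⟨s₀, h⟩ := hA.exists_stage (blockStart M J (i + 2))
  exact ⟨s₀, fun s hs => eventCount_congr he (h s hs)⟩

/-- This is the ordered code: `false` means agreement. The answer can only be positive after `x`
enters, and the rank test then succeeds at some stage exactly when it succeeds for the final count.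
-/
theorem bit_of_ordered (hA : IsEnumeration A) (he : e ≤ i) (hd : Follows A M J z e d i)
    (hi : Settled A M J z e d i) {x : ℕ} (hx : x < chunkSize M J)
    (ho : x % M = z ∨ (e < i ∧ GroupFull (limitStage A) M J z e 0 i)) {S : ℕ → Prop}
    (hS : ∀ y, (y % M = z ↔ x % M = z) ↔ S y) :
    d (cell M J e i x) = false ↔ limitStage A 0 (cell M J e i x) ∧
      limitCount A M J z e i ≤ limitRank A M J e i S x := by
  have key : (∃ s, Chain A M J z e d s i ∧ Answer A M J z e s i x) ↔
      limitStage A 0 (cell M J e i x) ∧ limitRank A M J e i S x < limitCount A M J z e i := by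
    -- The chain guard fixes the code: no stage that satisfies it can still misjudge fullness.
    have ho' : ∀ s, Chain A M J z e d s i →
        (x % M = z ∨ (e < i ∧ GroupFull A M J z e s i)) := fun s hs =>
      ho.imp_right fun h => ⟨h.1, (hi.groupFull s hs h.1).2 h.2⟩
    constructor
    · rintro ⟨s, hs, h | h⟩
      · refine ⟨⟨s, h.2.1⟩, ?_⟩
        rw [← rank_eq_limitRank hA hS h.2.1]
        exact h.2.2.trans_le (eventCount_le_limitCount s)
      · exact absurd (ho' s hs) h.1
    · rintro ⟨hl, hlt⟩
      obtain ⟨s₀, h₀⟩ := hi.chain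
      obtain ⟨s₁, h₁⟩ := eventCount_eventually (M := M) (J := J) (z := z) hA he
      obtain ⟨s₂, h₂⟩ := hl
      have hs := h₀ (max s₀ (max s₁ s₂)) (le_max_left _ _)
      have hAs := hA.mono (show s₂ ≤ max s₀ (max s₁ s₂) by omega) h₂
      refine ⟨_, hs, Or.inl ⟨ho' _ hs, hAs, ?_⟩⟩
      rw [rank_eq_limitRank hA hS hAs, h₁ _ (by omega)]
      exact hlt
  have := hd x hx
  rw [key] at this
  rw [← Bool.not_eq_true, this]
  by_cases hl : limitStage A 0 (cell M J e i x)
  · simp [hl]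
  · simp [hl]

/-- An entered cell is always accepted, hence mismatched. A cell that never enters is accepted, and
then agrees, exactly when its group number lies below the final count. -/
theorem bit_of_not_ordered (hA : IsEnumeration A) (he : e ≤ i) (hd : Follows A M J z e d i)
    (hi : Settled A M J z e d i) {x : ℕ} (hx : x < chunkSize M J)
    (ho : ¬ (x % M = z ∨ (e < i ∧ GroupFull (limitStage A) M J z e 0 i))) :
    d (cell M J e i x) = false ↔ ¬ limitStage A 0 (cell M J e i x) ∧
      x / M % (J + 1) < limitCount A M J z e i := by
  have key : (∃ s, Chain A M J z e d s i ∧ Answer A M J z e s i x) ↔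
      limitStage A 0 (cell M J e i x) ∨ x / M % (J + 1) < limitCount A M J z e i := by
    have ho' : ∀ s, Chain A M J z e d s i →
        ¬ (x % M = z ∨ (e < i ∧ GroupFull A M J z e s i)) := fun s hs h =>
      ho (h.imp_right fun h => ⟨h.1, (hi.groupFull s hs h.1).1 h.2⟩)
    constructor
    · rintro ⟨s, hs, h | h⟩
      · exact absurd h.1 (ho' s hs)
      · exact h.2.imp (fun h => ⟨s, h⟩) fun h => h.trans_le (eventCount_le_limitCount s)
    · intro h
      obtain ⟨s₀, h₀⟩ := hi.chain
      obtain ⟨s₁, h₁⟩ := eventCount_eventually (M := M) (J := J) (z := z) hA he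
      rcases h with ⟨s₂, h₂⟩ | h
      · exact ⟨_, h₀ (max s₀ s₂) (le_max_left _ _), Or.inr ⟨ho' _ (h₀ _ (le_max_left _ _)),
          Or.inl (hA.mono (le_max_right _ _) h₂)⟩⟩
      · refine ⟨_, h₀ (max s₀ s₁) (le_max_left _ _), Or.inr ⟨ho' _ (h₀ _ (le_max_left _ _)),
          Or.inr ?_⟩⟩
        rwa [h₁ _ (le_max_right _ _)]
  have := hd x hx
  rw [key] at this
  rw [← Bool.not_eq_true, this]
  by_cases hl : limitStage A 0 (cell M J e i x)
  · simp [hl]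
  · simp [hl]

theorem le_card_enumerated {S : ℕ → Prop} {p m : ℕ} (hp : p < M) (hm : m < J + 1)
    (hS : ∀ x, x % M = p → S x) (h : ∀ x < chunkSize M J, x % M = p → x / M % (J + 1) = m →
      limitStage A 0 (cell M J e i x)) :
    J + 2 ≤ (enumerated A M J e i S).card := by
  have hinj : Function.Injective fun y => p + M * (m + (J + 1) * y) := by
    intro y y' hy
    have h1 := Nat.eq_of_mul_eq_mul_left (by omega : 0 < M) (Nat.add_left_cancel hy)
    exact Nat.eq_of_mul_eq_mul_left (Nat.succ_pos J) (Nat.add_left_cancel h1)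
  calc J + 2 = ((Finset.range (J + 2)).image fun y => p + M * (m + (J + 1) * y)).card := by
        rw [Finset.card_image_of_injective _ hinj, Finset.card_range]
    _ ≤ _ := Finset.card_le_card fun x hx => by
        obtain ⟨y, hy, rfl⟩ := Finset.mem_image.1 hx
        have := cell_coordinates hp hm (Finset.mem_range.1 hy)
        exact mem_enumerated.2 ⟨this.1, hS _ this.2.1, h _ this.1 this.2.1 this.2.2⟩

/-- The count is at most J+1, so among J+2 entered cells some rank reaches it; that cell agrees.
This is why a group has J+2 copies in each part. -/
theorem exists_zero {S : ℕ → Prop} (hA : IsEnumeration A)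
    (hS : ∀ x < chunkSize M J, S x → (d (cell M J e i x) = false ↔
      limitStage A 0 (cell M J e i x) ∧
        limitCount A M J z e i ≤ limitRank A M J e i S x))
    (hc : J + 2 ≤ (enumerated A M J e i S).card) :
    ∃ x < chunkSize M J, S x ∧ d (cell M J e i x) = false := by
  have hle : limitCount A M J z e i ≤ J + 1 := eventCount_le _ _ _ _ _ _ _
  obtain ⟨x, hx, h⟩ := exists_le_rank _ (entryTime_cell_injOn hA S)
    (show limitCount A M J z e i < (enumerated A M J e i S).card by omega)
  have hx' := mem_enumerated.1 hx
  exact ⟨x, hx'.1, hx'.2.1, (hS x hx'.1 hx'.2.1).2 ⟨hx'.2.2, h⟩⟩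

section Side

variable {S : ℕ → Prop}

theorem card_filter_limitRank (hA : IsEnumeration A)
    (hS : ∀ x < chunkSize M J, S x → (d (cell M J e i x) = false ↔
      limitStage A 0 (cell M J e i x) ∧
        limitCount A M J z e i ≤ limitRank A M J e i S x))
    (h0 : ∃ x < chunkSize M J, S x ∧ d (cell M J e i x) = false) :
    ((enumerated A M J e i S).filter fun x =>
      limitRank A M J e i S x < limitCount A M J z e i).card = limitCount A M J z e i := by
  obtain ⟨x, hx, hSx, hdx⟩ := h0
  have h := (hS x hx hSx).1 hdx
  exact card_filter_rank_lt _ (entryTime_cell_injOn hA S)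
    (h.2.trans (rank_lt_card _ (mem_enumerated.2 ⟨hx, hSx, h.1⟩)).le)

/-- Agreeing cells come last in order of entry. Once one has entered, all mismatched cells that ever
enter have entered, and there are exactly as many as the final count. -/
theorem eventCount_eq_of_decoded (hA : IsEnumeration A)
    (hS : ∀ x < chunkSize M J, S x → (d (cell M J e i x) = false ↔
      limitStage A 0 (cell M J e i x) ∧
        limitCount A M J z e i ≤ limitRank A M J e i S x))
    (h0 : ∃ x < chunkSize M J, S x ∧ d (cell M J e i x) = false) {s : ℕ}
    (h : Decoded A M J z e d s i S) :
    eventCount A M J z e s i = limitCount A M J z e i := by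
  classical
  refine le_antisymm (eventCount_le_limitCount s) ?_
  refine (card_filter_limitRank hA hS h0).symm.le.trans (le_trans ?_ h.2)
  obtain ⟨x, hx, hSx, hdx⟩ := h0
  have hlx := (hS x hx hSx).1 hdx
  have hAx := h.1 x hx hSx hdx
  refine Finset.card_le_card fun y hy => ?_
  rw [Finset.mem_filter, mem_enumerated] at hy
  obtain ⟨⟨hy, hSy, hly⟩, hr⟩ := hy
  have hdy : d (cell M J e i y) = true := by
    rw [← Bool.not_eq_false, hS y hy hSy]
    omega
  refine Finset.mem_filter.2 ⟨Finset.mem_range.2 hy, hSy, hdy, ?_⟩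
  rw [hA.stage_iff hly]
  refine le_trans ?_ ((hA.stage_iff hlx.1).1 hAx)
  -- If `y` entered after the agreeing cell `x`, its rank would be at least that of `x`, hence at
  -- least the count.
  by_contra! hlt
  refine absurd (hr.trans_le hlx.2) (not_lt.2 (Finset.card_le_card fun w hw => ?_))
  rw [Finset.mem_filter] at hw ⊢
  exact ⟨hw.1, hw.2.trans hlt⟩

theorem decoded_eventually (hA : IsEnumeration A) (he : e ≤ i)
    (hS : ∀ x < chunkSize M J, S x → (d (cell M J e i x) = false ↔
      limitStage A 0 (cell M J e i x) ∧
        limitCount A M J z e i ≤ limitRank A M J e i S x))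
    (h0 : ∃ x < chunkSize M J, S x ∧ d (cell M J e i x) = false) :
    ∃ s₀, ∀ s ≥ s₀, Decoded A M J z e d s i S := by
  classical
  obtain ⟨s₀, h₀⟩ := hA.exists_stage (blockStart M J (i + 1))
  obtain ⟨s₁, h₁⟩ := eventCount_eventually (M := M) (J := J) (z := z) hA he
  refine ⟨max s₀ s₁, fun s hs => ⟨fun x hx hSx hdx => ?_, ?_⟩⟩
  · exact (h₀ s (by omega) _ (cell_lt he hx)).2 ((hS x hx hSx).1 hdx).1
  · rw [h₁ s (by omega)]
    refine le_trans (Finset.card_le_card fun x hx => ?_) (card_filter_limitRank hA hS h0).le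
    rw [Finset.mem_filter, Finset.mem_range] at hx
    obtain ⟨hx, hSx, hdx, hAx⟩ := hx
    have hl : limitStage A 0 (cell M J e i x) := ⟨s, hAx⟩
    refine Finset.mem_filter.2 ⟨mem_enumerated.2 ⟨hx, hSx, hl⟩, ?_⟩
    by_contra! hle
    rw [(hS x hx hSx).2 ⟨hl, hle⟩] at hdx
    exact Bool.false_ne_true hdx

end Side

section Round

variable (hA : IsEnumeration A) (he : e ≤ i) (hd : Follows A M J z e d i) (hi : Settled A M J z e d i)
include hA he hd hi

theorem bit_own {x : ℕ} (hx : x < chunkSize M J) (hxz : x % M = z) :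
    d (cell M J e i x) = false ↔ limitStage A 0 (cell M J e i x) ∧
      limitCount A M J z e i ≤ limitRank A M J e i (fun x => x % M = z) x :=
  bit_of_ordered hA he hd hi hx (Or.inl hxz) fun y => by simp [hxz]

theorem bit_other (hg : e < i ∧ GroupFull (limitStage A) M J z e 0 i)
    {x : ℕ} (hx : x < chunkSize M J) (hxz : x % M ≠ z) :
    d (cell M J e i x) = false ↔ limitStage A 0 (cell M J e i x) ∧
      limitCount A M J z e i ≤ limitRank A M J e i (fun x => x % M ≠ z) x :=
  bit_of_ordered hA he hd hi hx (Or.inr hg) fun y => by simp [hxz]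

/-- A full group contains the complete share of some part other than `z`, which exists because there
are at least two parts. -/
theorem exists_zero_other (hM : 2 ≤ M)
    (hg : e < i ∧ GroupFull (limitStage A) M J z e 0 i) :
    ∃ x < chunkSize M J, x % M ≠ z ∧ d (cell M J e i x) = false := by
  obtain ⟨p, hp, hpz⟩ : ∃ p < M, p ≠ z := by
    rcases Nat.eq_zero_or_pos z with h | h
    · exact ⟨1, by omega, by omega⟩
    · exact ⟨0, by omega, by omega⟩
  obtain ⟨m, hm, h⟩ := hg.2
  refine exists_zero hA (fun x hx => bit_other hA he hd hi hg hx)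
    (le_card_enumerated hp hm (fun x hx => by omega) fun x hx h1 h2 => h x hx (by omega) h2)

/-- Soundness of decoding: a stage that passes the test has seen all announced events. `Informed` is
needed only for the unordered code, where the witness in the last group below the count agrees and
forces the count up. -/
theorem eventCount_eq_of_roundOk (hM : 2 ≤ M) (hinf : Informed A M J z e d i)
    {s : ℕ} (hs : Chain A M J z e d s i) (h : RoundOk A M J z e d s i) :
    eventCount A M J z e s i = limitCount A M J z e i := by
  have hg : (e < i ∧ GroupFull A M J z e s i) ↔
      (e < i ∧ GroupFull (limitStage A) M J z e 0 i) :=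
    and_congr_right fun hei => hi.groupFull s hs hei
  rcases h with ⟨h0, h⟩ | ⟨h0, ⟨h1, h⟩ | ⟨h1, h⟩⟩
  · exact eventCount_eq_of_decoded hA (fun x hx => bit_own hA he hd hi hx) h0 h
  · rw [hg] at h1
    exact eventCount_eq_of_decoded hA (fun x hx => bit_other hA he hd hi h1 hx)
      (exists_zero_other hA he hd hi hM h1) h
  · rw [hg] at h1
    have hle := eventCount_le_limitCount (A := A) (M := M) (J := J) (z := z) (e := e) (i := i) s
    rcases hinf with h2 | h2 | h2 | ⟨x, hx, hxz, h2, hl⟩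
    · exact absurd h2 h0
    · exact absurd h2 h1
    · omega
    · have := h x hx hxz ((bit_of_not_ordered hA he hd hi hx (by tauto)).2 ⟨hl, by omega⟩)
      omega

/-- Completeness of decoding, which does not need `Informed`: the announced value never exceeds the
final count, so waiting for it terminates. -/
theorem roundOk_eventually (hM : 2 ≤ M) :
    ∃ s₀, ∀ s ≥ s₀, RoundOk A M J z e d s i := by
  obtain ⟨s₀, h₀⟩ := hi.chain
  have hg : ∀ s ≥ s₀, ((e < i ∧ GroupFull A M J z e s i) ↔
      (e < i ∧ GroupFull (limitStage A) M J z e 0 i)) := fun s hs =>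
    and_congr_right fun hei => hi.groupFull s (h₀ s hs) hei
  by_cases h0 : ∃ x < chunkSize M J, x % M = z ∧ d (cell M J e i x) = false
  · obtain ⟨s₁, h₁⟩ := decoded_eventually hA he (fun x hx => bit_own hA he hd hi hx) h0
    exact ⟨s₁, fun s hs => Or.inl ⟨h0, h₁ s hs⟩⟩
  by_cases h1 : e < i ∧ GroupFull (limitStage A) M J z e 0 i
  · obtain ⟨s₁, h₁⟩ := decoded_eventually hA he (fun x hx => bit_other hA he hd hi h1 hx)
      (exists_zero_other hA he hd hi hM h1)
    exact ⟨max s₀ s₁, fun s hs => Or.inr ⟨h0, Or.inl ⟨(hg s (by omega)).2 h1, h₁ s (by omega)⟩⟩⟩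
  · obtain ⟨s₁, h₁⟩ := eventCount_eventually (M := M) (J := J) (z := z) hA he
    refine ⟨max s₀ s₁, fun s hs => Or.inr ⟨h0, Or.inr ⟨fun h => h1 ((hg s (by omega)).1 h),
      fun x hx hxz hdx => ?_⟩⟩⟩
    rw [h₁ s (by omega)]
    exact ((bit_of_not_ordered hA he hd hi hx (by tauto)).1 hdx).2

end Round

theorem settled_self : Settled A M J z e d e where
  chain := ⟨0, fun _ _ _ hj he => absurd hj (not_lt.2 he)⟩
  groupFull := fun _ _ h => absurd h (lt_irrefl _)

theorem chain_succ {s : ℕ} (he : e ≤ i) : Chain A M J z e d s (i + 1) ↔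
    Chain A M J z e d s i ∧ RoundOk A M J z e d s i := by
  constructor
  · exact fun h => ⟨fun j hj => h j (by omega), h i (by omega) he⟩
  · rintro ⟨h1, h2⟩ j hj hej
    rcases Nat.lt_succ_iff_lt_or_eq.1 hj with h | rfl
    · exact h1 j h hej
    · exact h2

/-- After block `e`, fullness is either available to the code or fails, and in the latter case the
last group below a positive count has a cell that never enters. -/
theorem informed_succ (he : e ≤ i) : Informed A M J z e d (i + 1) := by
  by_cases hg : GroupFull (limitStage A) M J z e 0 (i + 1)
  · exact Or.inr (Or.inl ⟨by omega, hg⟩)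
  refine Or.inr (Or.inr ?_)
  have hle : limitCount A M J z e (i + 1) ≤ J + 1 := eventCount_le _ _ _ _ _ _ _
  rcases Nat.eq_zero_or_pos (limitCount A M J z e (i + 1)) with hc | hc
  · exact Or.inl hc
  · unfold GroupFull at hg
    push Not at hg
    obtain ⟨x, hx, h1, h2, h3⟩ := hg (limitCount A M J z e (i + 1) - 1) (by omega)
    exact Or.inr ⟨x, hx, h1, by omega, h3⟩

/-- A passed test in block `i` means that the count of events of block `i + 1` is final, and
fullness of a group is one of those events. -/
theorem settled_succ (hM : 2 ≤ M) (hA : IsEnumeration A) (he : e ≤ i)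
    (hd : Follows A M J z e d i) (hi : Settled A M J z e d i)
    (hinf : Informed A M J z e d i) : Settled A M J z e d (i + 1) where
  chain := by
    obtain ⟨s₀, h₀⟩ := hi.chain
    obtain ⟨s₁, h₁⟩ := roundOk_eventually hA he hd hi hM
    exact ⟨max s₀ s₁, fun s hs => (chain_succ he).2 ⟨h₀ s (by omega), h₁ s (by omega)⟩⟩
  groupFull := by
    intro s hs _
    obtain ⟨h1, h2⟩ := (chain_succ he).1 hs
    exact (eventCount_eq_imp (A' := limitStage A) (fun _ h => ⟨s, h⟩)
      (eventCount_eq_of_roundOk hA he hd hi hM hinf h1 h2) (by omega)).1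

theorem settled_and_informed (hM : 2 ≤ M) (hA : IsEnumeration A)
    (hd : ∀ i ≥ e, Follows A M J z e d i) (hinf : Informed A M J z e d e) (he : e ≤ i) :
    Settled A M J z e d i ∧ Informed A M J z e d i := by
  induction i, he using Nat.le_induction with
  | base => exact ⟨settled_self, hinf⟩
  | succ i he ih => exact ⟨settled_succ hM hA he (hd i he) ih.1 ih.2, informed_succ he⟩

/-- Only one player can fail to be informed in the first block. -/
theorem informed_of_not_informed (hA : IsEnumeration A) {z' : ℕ} {d' : ℕ → Bool} (hz' : z' < M)
    (hne : z' ≠ z) (h : ¬ Informed A M J z e d e) (hd : Follows A M J z' e d' e) :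
    Informed A M J z' e d' e := by
  unfold Informed at h
  push Not at h
  obtain ⟨-, -, hc, h⟩ := h
  have hle : limitCount A M J z e e ≤ J + 1 := eventCount_le _ _ _ _ _ _ _
  -- The group just below the count of `z` is entirely enumerated outside the part of `z`, so in
  -- particular inside the part of `z'`.
  refine Or.inl (exists_zero hA (fun x hx => bit_own hA le_rfl hd settled_self hx)
    (le_card_enumerated hz' (m := limitCount A M J z e e - 1) (by omega) (fun _ h => h)
      fun x hx h1 h2 => h x hx (by omega) (by omega)))

/-- Acceptance is decided at the first stage satisfying the chain. A mismatch can only be a position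
that enters after it, and the count is final by then. -/
theorem payloadErrors_lt (hM : 2 ≤ M) (hA : IsEnumeration A)
    (hd : ∀ i ≥ e, Follows A M J z e d i) (hinf : Informed A M J z e d e) (he : e < i)
    (hp : ∀ k < J * width M J i, (d (payload M J i k) = true ↔
      ((∃ s, Chain A M J z e d s i ∧ ¬ A s (payload M J i k)) ↔
        limitStage A 0 (payload M J i k)))) :
    payloadErrors M J d i < width M J i := by
  classical
  obtain ⟨i, rfl⟩ : ∃ j, i = j + 1 := ⟨i - 1, by omega⟩
  have he' : e ≤ i := by omega
  have hi := settled_and_informed hM hA hd hinf he'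
  obtain ⟨s₀, h₀⟩ := (settled_and_informed hM hA hd hinf he.le).1.chain
  have hex : ∃ s, Chain A M J z e d s (i + 1) := ⟨s₀, h₀ s₀ le_rfl⟩
  obtain ⟨h1, h2⟩ := (chain_succ he').1 (Nat.find_spec hex)
  have hcount := eventCount_eq_of_roundOk hA he' (hd i he') hi.1 hM hi.2 h1 h2
  refine lt_of_le_of_lt (Finset.card_le_card fun k hk => ?_)
    (eventCount_eq_imp (A' := limitStage A) (fun _ h => ⟨_, h⟩) hcount (by omega)).2
  rw [Finset.mem_filter, Finset.mem_range] at hk ⊢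
  have hk2 := (hp k hk.1).1 hk.2
  refine ⟨hk.1, ?_⟩
  by_cases hl : limitStage A 0 (payload M J (i + 1) k)
  · obtain ⟨s, hs, hAs⟩ := hk2.2 hl
    exact ⟨hl, fun h => hAs (hA.mono (Nat.find_min' hex hs) h)⟩
  · exact absurd (hk2.1 ⟨_, Nat.find_spec hex, fun h => hl ⟨_, h⟩⟩) hl

end Tracking


/-! ### From histories to mismatch bits -/

section Game

open Classical in
/-- The bit recorded by the history in position `n`. -/
noncomputable def mismatch (L₁ L₂ : Language Bool) (n : ℕ) : Bool :=
  decide (history L₁ L₂ n ∈ symmDiff L₁ L₂)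

variable {L₁ L₂ : Language Bool}

theorem length_history (n : ℕ) : (history L₁ L₂ n).length = n := by
  induction n with
  | zero => rfl
  | succ n ih => simp [history, ih]

theorem bits_history {n k : ℕ} (hk : k < n) :
    bits (history L₁ L₂ n) k = mismatch L₁ L₂ k := by
  induction n with
  | zero => omega
  | succ n ih =>
    have hl := length_history (L₁ := L₁) (L₂ := L₂) n
    rcases Nat.lt_succ_iff_lt_or_eq.1 hk with h | rfl
    · rw [← ih h]
      unfold bits
      rw [history, List.getD_append _ _ _ _ (by omega)]
    · unfold bits
      rw [history, List.getD_append_right _ _ _ _ (by omega), hl]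
      simp [mismatch]

theorem mismatch_eq_true {n : ℕ} {p q : Prop} (h₁ : history L₁ L₂ n ∈ L₁ ↔ p)
    (h₂ : history L₁ L₂ n ∈ L₂ ↔ ¬ q) : mismatch L₁ L₂ n = true ↔ (p ↔ q) := by
  classical
  have : history L₁ L₂ n ∈ symmDiff L₁ L₂ ↔
      (history L₁ L₂ n ∈ L₁ ∧ history L₁ L₂ n ∉ L₂) ∨
        (history L₁ L₂ n ∈ L₂ ∧ history L₁ L₂ n ∉ L₁) := Iff.rfl
  unfold mismatch
  rw [decide_eq_true_iff, this, h₁, h₂]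
  tauto

theorem rePred_comp_computable {α β : Type*} [Primcodable α] [Primcodable β] {p : β → Prop}
    (hp : REPred p) {f : α → β} (hf : Computable f) : REPred fun a => p (f a) :=
  Partrec.comp hp hf

/-- The words `List.replicate n false` represent the lengths, and a nonadaptive language is
determined by them. -/
theorem exists_code {L : Language Bool} (hL : L ∈ Pi01) :
    ∃ e, ∀ n, limitStage (enumStage e) 0 n ↔ List.replicate n false ∉ L := by
  have hc : Computable fun n => List.replicate n false :=
    ((Primrec.list_map Primrec.list_range (Primrec₂.const false)).of_eq
      fun n => by simp [List.map_const']).to_comp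
  have h : REPred fun n : ℕ => List.replicate n false ∉ L := rePred_comp_computable hL hc
  have h' : Partrec fun n : ℕ =>
      (Part.assert (List.replicate n false ∉ L) fun _ => Part.some ()).map fun _ => (0 : ℕ) :=
    Partrec.map h (Computable.const 0).to₂
  obtain ⟨c, hc⟩ := Nat.Partrec.Code.exists_code.1 (Partrec.nat_iff.1 h')
  refine ⟨Encodable.encode c, fun n => ?_⟩
  rw [limitStage_enumStage, Denumerable.ofNat_encode, hc]
  simp [Part.assert]

section Links

variable {M J z : ℕ} (hM : 0 < M)
include hM

theorem mem_pursuer_cell {e i x : ℕ} (he : e ≤ i) (hx : x < chunkSize M J) :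
    history (pursuer M J z) L₂ (cell M J e i x) ∈ pursuer M J z ↔
      ∃ s, Chain (enumStage e) M J z e (mismatch (pursuer M J z) L₂) s i ∧
        Answer (enumStage e) M J z e s i x := by
  have hidx := blockIndex_eq hM (blockStart_le_cell M J e i x) (cell_lt he hx)
  have hoff : blockOffset M J (cell M J e i x) = e * chunkSize M J + x := by
    unfold blockOffset
    rw [hidx]
    unfold cell
    omega
  have hdiv : (e * chunkSize M J + x) / chunkSize M J = e := by
    rw [mul_comm, Nat.mul_add_div (chunkSize_pos hM), Nat.div_eq_of_lt hx, add_zero]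
  have hmod : (e * chunkSize M J + x) % chunkSize M J = x := by
    rw [mul_comm, Nat.mul_add_mod, Nat.mod_eq_of_lt hx]
  refine exists_congr fun s => ?_
  unfold AcceptsAt
  rw [length_history, hidx, hoff, hdiv, hmod]
  have hchain := chain_congr (A := enumStage e) (M := M) (J := J) (z := z) (e := e) (s := s)
    (i := i) (β := bits (history (pursuer M J z) L₂ (cell M J e i x)))
    (γ := mismatch (pursuer M J z) L₂) fun n hn =>
      bits_history (hn.trans_le (blockStart_le_cell M J e i x))
  rw [hchain]
  have := cell_offset_lt he hx
  tauto

theorem mem_pursuer_payload {e i k : ℕ} (hk : k < J * width M J i) (he : e < i)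
    (hh : hypothesis M J (mismatch (pursuer M J z) L₂) i = e) :
    history (pursuer M J z) L₂ (payload M J i k) ∈ pursuer M J z ↔
      ∃ s, Chain (enumStage e) M J z e (mismatch (pursuer M J z) L₂) s i ∧
        ¬ enumStage e s (payload M J i k) := by
  have hle : blockStart M J i ≤ payload M J i k := by unfold payload; omega
  have hidx := blockIndex_eq hM hle (payload_lt hk)
  have hoff : blockOffset M J (payload M J i k) = width M J i + k := by
    unfold blockOffset
    rw [hidx]
    unfold payload
    omega
  have hbits : ∀ n < blockStart M J i,
      bits (history (pursuer M J z) L₂ (payload M J i k)) n = mismatch (pursuer M J z) L₂ n :=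
    fun n hn => bits_history (hn.trans_le hle)
  refine exists_congr fun s => ?_
  unfold AcceptsAt
  rw [length_history, hidx, hoff, hypothesis_congr hbits, hh]
  have : ¬ width M J i + k < width M J i := by omega
  simp only [this, he, false_and, false_or, not_false_eq_true, true_and]
  rw [chain_congr hbits]

end Links

end Game

/-! ### Finding the right hypothesis -/

section Learning

variable {M J z e : ℕ} {L : Language Bool}

theorem mem_iff_not_limitStage (hL : IsNonadaptive L)
    (he : ∀ n, limitStage (enumStage e) 0 n ↔ List.replicate n false ∉ L)
    (L₁ : Language Bool) (n : ℕ) :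
    history L₁ L n ∈ L ↔ ¬ limitStage (enumStage e) 0 n := by
  rw [he, not_not]
  exact hL _ _ (by rw [length_history, List.length_replicate])

theorem follows_mismatch (hM : 0 < M) (hL : IsNonadaptive L)
    (he : ∀ n, limitStage (enumStage e) 0 n ↔ List.replicate n false ∉ L) {i : ℕ} (hi : e ≤ i) :
    Follows (enumStage e) M J z e (mismatch (pursuer M J z) L) i := fun _ hx =>
  mismatch_eq_true (mem_pursuer_cell hM hi hx) (mem_iff_not_limitStage hL he _ _)

theorem exists_payloadErrors_lt (hM : 2 ≤ M) (hL : IsNonadaptive L)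
    (he : ∀ n, limitStage (enumStage e) 0 n ↔ List.replicate n false ∉ L)
    (hinf : Informed (enumStage e) M J z e (mismatch (pursuer M J z) L) e) :
    ∃ i₀, ∀ i ≥ i₀, payloadErrors M J (mismatch (pursuer M J z) L) i < width M J i := by
  classical
  set d := mismatch (pursuer M J z) L with hd
  by_cases hbad : {i | width M J i ≤ payloadErrors M J d i}.Infinite
  · exfalso
    -- With infinitely many bad blocks, one is reached after exactly `Nat.pair e (e + 1)` earlier
    -- ones. There the hypothesis is `e`, and the second component `e + 1` makes the block number
    -- exceed `e`.
    have hmem := Nat.nth_mem_of_infinite hbad (Nat.pair e (e + 1))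
    have hcount := Nat.count_nth_of_infinite hbad (Nat.pair e (e + 1))
    set i := Nat.nth (fun i => width M J i ≤ payloadErrors M J d i) (Nat.pair e (e + 1))
    have hb : badCount M J d i = Nat.pair e (e + 1) := by
      rw [← hcount, Nat.count_eq_card_filter_range]
      unfold badCount
      congr
    have hh : hypothesis M J d i = e := by
      unfold hypothesis
      rw [hb, Nat.unpair_pair]
    have hei : e < i := by
      have h1 : Nat.pair e (e + 1) ≤ i := by
        rw [← hcount]
        exact Nat.count_le _
      have h2 := Nat.right_le_pair e (e + 1)
      omega
    refine absurd hmem (not_le.2 (payloadErrors_lt hM (isEnumeration_enumStage e)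
      (fun i hi => follows_mismatch (by omega) hL he hi) hinf hei fun k hk => ?_))
    exact mismatch_eq_true (mem_pursuer_payload (by omega) hk hei hh)
      (mem_iff_not_limitStage hL he _ _)
  · rw [Set.not_infinite] at hbad
    obtain ⟨B, hB⟩ := hbad.bddAbove
    refine ⟨B + 1, fun i hi => ?_⟩
    by_contra! h
    have := hB h
    omega

/-- At most one of the pursuers fails to learn a nonadaptive co-enumerable language. -/
theorem exists_exceptional_seed (hM : 2 ≤ M) (hL : IsNonadaptive L) (hL' : L ∈ Pi01) :
    ∃ z₀, ∀ z < M, z ≠ z₀ →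
      ∃ i₀, ∀ i ≥ i₀, payloadErrors M J (mismatch (pursuer M J z) L) i < width M J i := by
  obtain ⟨e, he⟩ := exists_code hL'
  by_cases h : ∃ z₀, ¬ Informed (enumStage e) M J z₀ e (mismatch (pursuer M J z₀) L) e
  · obtain ⟨z₀, h₀⟩ := h
    exact ⟨z₀, fun z hz hne => exists_payloadErrors_lt hM hL he
      (informed_of_not_informed (isEnumeration_enumStage e) hz hne h₀
        (follows_mismatch (by omega) hL he le_rfl))⟩
  · push Not at h
    exact ⟨0, fun z _ _ => exists_payloadErrors_lt hM hL he (h z)⟩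

end Learning

/-! ### Density of mismatches -/

section Counting

variable {M J : ℕ} (d : ℕ → Bool)

/-- The number of mismatches before position `N`. -/
def mismatchCount (N : ℕ) : ℕ := ((Finset.range N).filter fun n => d n = true).card

theorem mismatchCount_mono : Monotone (mismatchCount d) := fun _ _ h =>
  Finset.card_le_card (Finset.filter_subset_filter _ (Finset.range_mono h))

theorem mismatchCount_le (N : ℕ) : mismatchCount d N ≤ N :=
  (Finset.card_filter_le _ _).trans (Finset.card_range N).le

theorem mismatchCount_add (N K : ℕ) : mismatchCount d (N + K) =
    mismatchCount d N + ((Finset.range K).filter fun k => d (N + k) = true).card := by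
  unfold mismatchCount
  simp only [Finset.card_filter]
  exact Finset.sum_range_add _ _ _

variable {d}

/-- All reserved positions may be lost, which costs `width`; the payload costs less than another
`width`. -/
theorem mismatchCount_blockStart_succ {i : ℕ} (h : payloadErrors M J d i < width M J i) :
    mismatchCount d (blockStart M J (i + 1)) ≤
      mismatchCount d (blockStart M J i) + 2 * width M J i := by
  classical
  rw [blockStart_succ, ← add_assoc, mismatchCount_add, mismatchCount_add]
  have h1 := (Finset.card_filter_le (Finset.range (width M J i))
    fun k => d (blockStart M J i + k) = true).trans (Finset.card_range _).le
  have h2 : ((Finset.range (J * width M J i)).filter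
      fun k => d (blockStart M J i + width M J i + k) = true).card = payloadErrors M J d i := by
    unfold payloadErrors payload
    congr
  omega

theorem mismatchCount_blockStart {i₀ i : ℕ}
    (h : ∀ i ≥ i₀, payloadErrors M J d i < width M J i) (hi : i₀ ≤ i) :
    mismatchCount d (blockStart M J i) ≤ blockStart M J i₀ + 2 * chunkSize M J * (i * i) := by
  induction i, hi using Nat.le_induction with
  | base => exact (mismatchCount_le d _).trans (Nat.le_add_right _ _)
  | succ i hi ih =>
    have h1 := mismatchCount_blockStart_succ (h i hi)
    have h2 : 2 * chunkSize M J * ((i + 1) * (i + 1)) =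
        2 * chunkSize M J * (i * i) + 2 * width M J i := by
      unfold width; ring
    omega

theorem mismatchCount_eventually (hM : 0 < M) {i₀ : ℕ}
    (h : ∀ i ≥ i₀, payloadErrors M J d i < width M J i) :
    ∀ᶠ N in atTop, (J + 1) * mismatchCount d N ≤ 3 * N := by
  set B := (J + 1) * blockStart M J i₀ with hB
  filter_upwards [eventually_ge_atTop (blockStart M J (i₀ + B + 6))] with N hN
  have hC : 0 < chunkSize M J * (J + 1) := Nat.mul_pos (chunkSize_pos hM) (by omega)
  have h1 : blockStart M J (blockIndex M J N) ≤ N := by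
    have h := Nat.sqrt_le (N / (chunkSize M J * (J + 1)))
    rwa [Nat.le_div_iff_mul_le hC, mul_comm] at h
  have h2 : N < blockStart M J (blockIndex M J N + 1) := by
    have h := Nat.lt_succ_sqrt (N / (chunkSize M J * (J + 1)))
    rwa [Nat.div_lt_iff_lt_mul hC, mul_comm] at h
  set i := blockIndex M J N
  have hi : i₀ + B + 6 ≤ i := by
    by_contra! hlt
    have := blockStart_mono M J (show i + 1 ≤ i₀ + B + 6 by omega)
    omega
  have h3 := (mismatchCount_mono d h2.le).trans
    (mismatchCount_blockStart h (show i₀ ≤ i + 1 by omega))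
  have h4 : (J + 1) * mismatchCount d N ≤
      B + 2 * (chunkSize M J * (J + 1)) * ((i + 1) * (i + 1)) := by
    calc _ ≤ (J + 1) * (blockStart M J i₀ + 2 * chunkSize M J * ((i + 1) * (i + 1))) :=
          Nat.mul_le_mul_left _ h3
      _ = _ := by rw [hB]; ring
  -- Since `i ≥ B + 6`, the square of `i` absorbs `B + 4 * i + 2`: both the initial blocks and the
  -- current incomplete block fit into the slack between 2 and 3.
  have h5 : B + 2 * ((i + 1) * (i + 1)) ≤ 3 * (i * i) := by nlinarith
  unfold blockStart at h1
  calc _ ≤ B + 2 * (chunkSize M J * (J + 1)) * ((i + 1) * (i + 1)) := h4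
    _ ≤ chunkSize M J * (J + 1) * (B + 2 * ((i + 1) * (i + 1))) := by nlinarith
    _ ≤ chunkSize M J * (J + 1) * (3 * (i * i)) := Nat.mul_le_mul_left _ h5
    _ ≤ 3 * N := by linarith

end Counting


/-! ### Payoffs from mismatch densities -/

section Payoff

theorem liminf_add_limsup_mem_Icc {u : ℕ → ℝ} {a b : ℝ}
    (h : ∀ᶠ N in atTop, u N ∈ Set.Icc a b) :
    liminf u atTop + limsup u atTop ∈ Set.Icc (2 * a) (2 * b) := by
  have ha : ∀ᶠ N in atTop, a ≤ u N := h.mono fun _ h => h.1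
  have hb : ∀ᶠ N in atTop, u N ≤ b := h.mono fun _ h => h.2
  have hba : IsBoundedUnder (· ≥ ·) atTop u := ⟨a, ha⟩
  have hbb : IsBoundedUnder (· ≤ ·) atTop u := ⟨b, hb⟩
  have h1 : a ≤ liminf u atTop := le_liminf_of_le hbb.isCoboundedUnder_ge ha
  have h2 : limsup u atTop ≤ b := limsup_le_of_le hba.isCoboundedUnder_le hb
  have h3 : liminf u atTop ≤ limsup u atTop := liminf_le_limsup hbb hba
  constructor <;> linarith

variable (L₁ L₂ : Language Bool)

/-- The shift is in the indexing: `delta` at `n` is the mismatch bit at position `n - 1`. -/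
theorem sum_delta (N : ℕ) :
    ∑ n ∈ Finset.Icc 1 N, delta L₁ L₂ n = mismatchCount (mismatch L₁ L₂) N := by
  classical
  induction N with
  | zero => simp [mismatchCount]
  | succ N ih =>
    rw [Finset.sum_Icc_succ_top (by omega), ih]
    unfold mismatchCount delta mismatch
    rw [Finset.card_filter, Finset.card_filter, Finset.sum_range_succ]
    push_cast
    simp

theorem average_delta (N : ℕ) :
    ∑ n ∈ Finset.Icc 1 N, delta L₁ L₂ n / (2 * (N : ℝ)) =
      mismatchCount (mismatch L₁ L₂) N / (2 * (N : ℝ)) := by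
  rw [← Finset.sum_div, sum_delta]

theorem average_one_sub_delta {N : ℕ} (hN : 0 < N) :
    ∑ n ∈ Finset.Icc 1 N, (1 - delta L₁ L₂ n) / (2 * (N : ℝ)) =
      1 / 2 - mismatchCount (mismatch L₁ L₂) N / (2 * (N : ℝ)) := by
  rw [← Finset.sum_div, Finset.sum_sub_distrib, sum_delta]
  have : (N : ℝ) ≠ 0 := by positivity
  simp
  field_simp

variable {L₁ L₂}

theorem payoff_bounds {r : ℝ}
    (h : ∀ᶠ N : ℕ in atTop, (mismatchCount (mismatch L₁ L₂) N : ℝ) ≤ r * N) :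
    payoffNe L₁ L₂ ∈ Set.Icc 0 r ∧ payoffEq L₁ L₂ ∈ Set.Icc (1 - r) 1 := by
  have key : ∀ᶠ N : ℕ in atTop, 0 < N ∧
      (mismatchCount (mismatch L₁ L₂) N / (2 * (N : ℝ))) ∈ Set.Icc 0 (r / 2) := by
    filter_upwards [h, eventually_gt_atTop 0] with N hN hpos
    have : (0 : ℝ) < N := by exact_mod_cast hpos
    refine ⟨hpos, by positivity, ?_⟩
    rw [div_le_iff₀ (by positivity)]
    linarith
  constructor
  · have := liminf_add_limsup_mem_Icc (a := 0) (b := r / 2)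
      (u := fun N : ℕ => ∑ n ∈ Finset.Icc 1 N, delta L₁ L₂ n / (2 * (N : ℝ)))
      (key.mono fun N hN => by rw [average_delta]; exact hN.2)
    unfold payoffNe
    constructor
    · linarith [this.1]
    · linarith [this.2]
  · have := liminf_add_limsup_mem_Icc (a := 1 / 2 - r / 2) (b := 1 / 2)
      (u := fun N : ℕ => ∑ n ∈ Finset.Icc 1 N, (1 - delta L₁ L₂ n) / (2 * (N : ℝ)))
      (key.mono fun N hN => by
        rw [average_one_sub_delta _ _ hN.1]
        exact ⟨by linarith [hN.2.2], by linarith [hN.2.1]⟩)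
    unfold payoffEq
    constructor
    · linarith [this.1]
    · linarith [this.2]

theorem payoff_mem_Icc (L₁ L₂ : Language Bool) :
    payoffNe L₁ L₂ ∈ Set.Icc 0 1 ∧ payoffEq L₁ L₂ ∈ Set.Icc 0 1 := by
  have := payoff_bounds (L₁ := L₁) (L₂ := L₂) (r := 1) (Eventually.of_forall fun N => by
    rw [one_mul]; exact_mod_cast mismatchCount_le _ N)
  rwa [sub_self] at this

theorem exists_seed_payoff_bounds {M : ℕ} (J : ℕ) {L : Language Bool} (hM : 2 ≤ M)
    (hL : IsNonadaptive L) (hL' : L ∈ Pi01) :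
    ∃ z₀, ∀ z < M, z ≠ z₀ → payoffNe (pursuer M J z) L ≤ 3 / (J + 1) ∧
      1 - 3 / (J + 1) ≤ payoffEq (pursuer M J z) L := by
  obtain ⟨z₀, h₀⟩ := exists_exceptional_seed (J := J) hM hL hL'
  refine ⟨z₀, fun z hz hne => ?_⟩
  obtain ⟨i₀, h⟩ := h₀ z hz hne
  have := payoff_bounds (L₁ := pursuer M J z) (L₂ := L) (r := 3 / (J + 1))
    ((mismatchCount_eventually (by omega) h).mono fun N hN => by
      rw [div_mul_eq_mul_div, le_div_iff₀ (by positivity), mul_comm]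
      exact_mod_cast hN)
  exact ⟨this.1.2, this.2.1⟩

end Payoff

/-! ### Expectations under a finite uniform mixture -/

section Expectation

theorem hasSum_pmf_toReal {α : Type*} (p : PMF α) : HasSum (fun a => (p a).toReal) 1 := by
  have h := (ENNReal.summable_toReal p.tsum_coe_ne_top).hasSum
  rwa [← ENNReal.tsum_toReal_eq fun a => p.apply_ne_top a, p.tsum_coe, ENNReal.toReal_one] at h

/-- The mixture is expanded as a sum of point masses over the index set, so repetitions in `L` do no
harm. -/
theorem hasSum_map_uniform {α : Type*} {n : ℕ} (L : Fin (n + 1) → α) (g : α → ℝ) :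
    HasSum (fun a => (((PMF.uniformOfFintype (Fin (n + 1))).map L) a).toReal * g a)
      ((∑ i, g (L i)) / (n + 1)) := by
  classical
  have h : ∀ a, (((PMF.uniformOfFintype (Fin (n + 1))).map L) a).toReal * g a =
      ∑ i, if a = L i then g (L i) / (n + 1) else 0 := by
    intro a
    rw [PMF.map_apply, tsum_fintype, ENNReal.toReal_sum, Finset.sum_mul]
    · refine Finset.sum_congr rfl fun i _ => ?_
      split_ifs with hi
      · rw [hi, PMF.uniformOfFintype_apply, Fintype.card_fin, ENNReal.toReal_inv,
          ENNReal.toReal_natCast]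
        push_cast
        ring
      · simp
    · intro i _
      split_ifs
      · exact PMF.apply_ne_top _ _
      · exact ENNReal.zero_ne_top
  simp only [h]
  rw [Finset.sum_div]
  exact hasSum_sum fun i _ => hasSum_ite_eq (L i) _

variable {α β : Type*} {n : ℕ}

/-- Bounds for the average against each point give bounds for the expectation. -/
theorem tsum_map_uniform_mem_Icc (L : Fin (n + 1) → α) (q : PMF β) {f : α → β → ℝ}
    (hf : ∀ a b, f a b ∈ Set.Icc 0 1) {u v : ℝ}
    (h : ∀ b, (∑ i, f (L i) b) / (n + 1) ∈ Set.Icc u v) :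
    ∑' p : α × β, (((PMF.uniformOfFintype (Fin (n + 1))).map L) p.1).toReal *
      (q p.2).toReal * f p.1 p.2 ∈ Set.Icc u v := by
  set r := (PMF.uniformOfFintype (Fin (n + 1))).map L
  have hs : Summable fun p : α × β => (r p.1).toReal * (q p.2).toReal * f p.1 p.2 := by
    refine Summable.of_nonneg_of_le (fun p => ?_) (fun p => ?_)
      ((hasSum_pmf_toReal r).summable.mul_of_nonneg (hasSum_pmf_toReal q).summable
        (fun _ => ENNReal.toReal_nonneg) fun _ => ENNReal.toReal_nonneg)
    · exact mul_nonneg (mul_nonneg ENNReal.toReal_nonneg ENNReal.toReal_nonneg) (hf _ _).1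
    · exact mul_le_of_le_one_right (mul_nonneg ENNReal.toReal_nonneg ENNReal.toReal_nonneg)
        (hf _ _).2
  have hsum : HasSum (fun b => (q b).toReal * ((∑ i, f (L i) b) / (n + 1)))
      (∑' p : α × β, (r p.1).toReal * (q p.2).toReal * f p.1 p.2) := by
    -- Summing over the pursuer first, for a fixed evader language, makes the pointwise averages
    -- appear.
    refine ((Equiv.prodComm β α).hasSum_iff.2 hs.hasSum).prod_fiberwise fun b => ?_
    refine ((hasSum_map_uniform L fun a => f a b).mul_left (q b).toReal).congr_fun
      fun a => ?_
    simp only [Function.comp, Equiv.prodComm_apply, Prod.swap]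
    ring
  constructor
  · have h1 := (hasSum_pmf_toReal q).mul_right u
    rw [one_mul] at h1
    exact hasSum_le (fun b => mul_le_mul_of_nonneg_left (h b).1 ENNReal.toReal_nonneg) h1 hsum
  · have h1 := (hasSum_pmf_toReal q).mul_right v
    rw [one_mul] at h1
    exact hasSum_le (fun b => mul_le_mul_of_nonneg_left (h b).2 ENNReal.toReal_nonneg) hsum h1

theorem sum_le_of_exceptional {M : ℕ} {g : Fin M → ℝ} {r : ℝ} (hr : 0 ≤ r) (z₀ : ℕ)
    (h1 : ∀ z, g z ≤ 1) (h : ∀ z : Fin M, (z : ℕ) ≠ z₀ → g z ≤ r) :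
    ∑ z, g z ≤ 1 + M * r := by
  calc ∑ z, g z ≤ ∑ z : Fin M, ((if (z : ℕ) = z₀ then 1 else 0) + r) := by
        refine Finset.sum_le_sum fun z _ => ?_
        split_ifs with hz
        · linarith [h1 z]
        · linarith [h z hz]
    _ ≤ 1 + M * r := by
        rw [Finset.sum_add_distrib, Finset.sum_const, Finset.card_univ, Fintype.card_fin,
          nsmul_eq_mul, Finset.sum_ite, Finset.sum_const_zero, add_zero, Finset.sum_const,
          nsmul_eq_mul, mul_one]
        gcongr
        norm_cast
        refine Finset.card_le_one.2 fun a ha b hb => ?_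
        rw [Finset.mem_filter] at ha hb
        exact Fin.ext (ha.2.trans hb.2.symm)

end Expectation

/-! ### The mixed strategies and the value of the game -/

section Main

/-- The family of pursuers that are mixed in the `k`-th strategy. -/
def family (k : ℕ) (z : Fin (k + 1 + 1)) : Sigma01 :=
  ⟨pursuer (k + 2) k z, pursuer_mem_Sigma01 (k + 2) k z⟩

/-- The `k`-th mixed strategy of the pursuer. -/
noncomputable def strategy (k : ℕ) : MixedStrategy Sigma01 :=
  (PMF.uniformOfFintype (Fin (k + 1 + 1))).map (family k)

/-- With M = k+2 players and J = k, the exceptional player contributes at most 1/(k+2) and the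
others at most 3/(k+1). -/
theorem average_bounds (k : ℕ) {L : Language Bool} (hL : IsNonadaptive L) (hL' : L ∈ Pi01) :
    (∑ z, payoffNe (family k z) L) / ((k + 1 : ℕ) + 1) ≤ 4 / (k + 1 : ℝ) ∧
      1 - 4 / (k + 1 : ℝ) ≤ (∑ z, payoffEq (family k z) L) / ((k + 1 : ℕ) + 1) := by
  obtain ⟨z₀, h₀⟩ := exists_seed_payoff_bounds (M := k + 2) k (by omega) hL hL'
  have hr : (0 : ℝ) ≤ 3 / (k + 1) := by positivity
  have h1 := sum_le_of_exceptional (g := fun z => payoffNe (family k z) L) hr z₀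
    (fun z => (payoff_mem_Icc _ _).1.2) fun z hz => (h₀ z z.2 hz).1
  have h2 := sum_le_of_exceptional (g := fun z => 1 - payoffEq (family k z) L) hr z₀
    (fun z => by linarith [(payoff_mem_Icc (family k z) L).2.1]) fun z hz => by
      have := (h₀ z z.2 hz).2
      change 1 - payoffEq (pursuer (k + 2) k z) L ≤ _
      linarith
  have key : (1 + ((k + 1 + 1 : ℕ) : ℝ) * (3 / (k + 1))) / ((k + 1 : ℕ) + 1) ≤ 4 / (k + 1 : ℝ) := by
    push_cast
    have : (1 + ((k : ℝ) + 1 + 1) * (3 / (k + 1))) / (k + 1 + 1) =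
        1 / (k + 1 + 1) + 3 / (k + 1) := by field_simp
    rw [this]
    have : (1 : ℝ) / (k + 1 + 1) ≤ 1 / (k + 1) :=
      one_div_le_one_div_of_le (by positivity) (by linarith)
    calc _ ≤ (1 : ℝ) / (k + 1) + 3 / (k + 1) := by linarith
      _ = _ := by ring
  constructor
  · exact (div_le_div_of_nonneg_right h1 (by positivity)).trans key
  · have h3 := (div_le_div_of_nonneg_right h2
      (show (0 : ℝ) ≤ (k + 1 : ℕ) + 1 by positivity)).trans key
    rw [Finset.sum_sub_distrib, sub_div] at h3
    have : (∑ _z : Fin (k + 1 + 1), (1 : ℝ)) / ((k + 1 : ℕ) + 1) = 1 := by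
      rw [Finset.sum_const, Finset.card_univ, Fintype.card_fin, nsmul_eq_mul, mul_one]
      push_cast
      exact div_self (by positivity)
    rw [this] at h3
    linarith

theorem expectedPayoff_strategy {C : Set (Language Bool)}
    (hC : ∀ L ∈ C, L ∈ Pi01 ∧ IsNonadaptive L) (k : ℕ) (E : MixedStrategy C) :
    expectedPayoffNe (strategy k) E ≤ 4 / (k + 1) ∧
      expectedPayoffEq (strategy k) E ∈ Set.Icc (1 - 4 / (k + 1) : ℝ) 1 := by
  refine ⟨(tsum_map_uniform_mem_Icc (family k) E
    (f := fun a b => payoffNe a b) (fun _ _ => (payoff_mem_Icc _ _).1)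
    (u := 0) fun b => ⟨?_, ?_⟩).2, tsum_map_uniform_mem_Icc (family k) E
    (f := fun a b => payoffEq a b) (fun _ _ => (payoff_mem_Icc _ _).2) fun b => ⟨?_, ?_⟩⟩
  · exact div_nonneg (Finset.sum_nonneg fun _ _ => (payoff_mem_Icc _ _).1.1) (by positivity)
  · exact (average_bounds k (hC b b.2).2 (hC b b.2).1).1
  · exact (average_bounds k (hC b b.2).2 (hC b b.2).1).2
  · rw [div_le_one (by positivity)]
    calc _ ≤ ∑ _z : Fin (k + 1 + 1), (1 : ℝ) :=
          Finset.sum_le_sum fun _ _ => (payoff_mem_Icc _ _).2.2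
      _ = _ := by simp

theorem tendsto_four_div : Tendsto (fun k : ℕ => 4 / (k + 1 : ℝ)) atTop (𝓝 0) := by
  have := (tendsto_one_div_add_atTop_nhds_zero_nat (𝕜 := ℝ)).const_mul 4
  simpa [div_eq_mul_inv] using this

theorem expectedPayoffNe_nonneg {C₁ C₂ : Set (Language Bool)} (D : MixedStrategy C₁)
    (E : MixedStrategy C₂) : 0 ≤ expectedPayoffNe D E :=
  tsum_nonneg fun _ => mul_nonneg (mul_nonneg ENNReal.toReal_nonneg ENNReal.toReal_nonneg)
    (payoff_mem_Icc _ _).1.1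

theorem NA_mem {w : ℕ → List Bool} (hw : Computable w) {L : Language Bool} (hL : L ∈ Pi01) :
    NA w L ∈ Pi01 ∧ IsNonadaptive (NA w L) := by
  refine ⟨?_, fun u v h => ?_⟩
  · exact rePred_comp_computable hL (hw.comp Computable.list_length)
  · change w u.length ∈ L ↔ w v.length ∈ L
    rw [h]

theorem minmax_eq_zero {C : Set (Language Bool)} (hC : ∀ L ∈ C, L ∈ Pi01 ∧ IsNonadaptive L) :
    minmax Sigma01 C = 0 := by
  have h0 : ∀ D : MixedStrategy Sigma01,
      0 ≤ ⨆ E : MixedStrategy C, expectedPayoffNe D E := fun D =>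
    Real.iSup_nonneg fun E => expectedPayoffNe_nonneg D E
  refine le_antisymm ?_ (Real.iInf_nonneg h0)
  refine ge_of_tendsto tendsto_four_div (Eventually.of_forall fun k => ?_)
  -- The real infimum needs a lower bound. `Real.iSup_le` asks for a nonnegative bound because an
  -- empty real supremum is 0.
  refine (ciInf_le ⟨0, ?_⟩ (strategy k)).trans
    (Real.iSup_le (fun E => (expectedPayoff_strategy hC k E).1) (by positivity))
  rintro _ ⟨D, rfl⟩
  exact h0 D

end Main

end IMP

theorem mainTheorem2 :
    (∀ w : ℕ → List Bool, Computable w → Function.Surjective w →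
      IMP.Learnable w IMP.Pi01) ∧
    ∃ D : ℕ → IMP.MixedStrategy IMP.Sigma01,
      (∀ k : ℕ, IMP.IsFiniteUniformMixture (D k)) ∧
      TendstoUniformly
        (fun (k : ℕ) (E : IMP.MixedStrategy {L | L ∈ IMP.Pi01 ∧ IMP.IsNonadaptive L}) =>
          IMP.expectedPayoffEq (D k) E)
        (fun _ => (1 : ℝ)) atTop := by
  refine ⟨fun w hw _ => ?_, IMP.strategy, fun k => ⟨k + 1, IMP.family k, rfl⟩, ?_⟩
  · refine IMP.minmax_eq_zero ?_
    rintro _ ⟨L, hL, rfl⟩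
    exact IMP.NA_mem hw hL
  · rw [Metric.tendstoUniformly_iff]
    intro ε hε
    filter_upwards [IMP.tendsto_four_div.eventually_lt_const hε] with k hk E
    have h := (IMP.expectedPayoff_strategy (fun _ h => h) k E).2
    rw [Real.dist_eq, abs_of_nonneg (by linarith [h.2])]
    linarith [h.1]
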